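/- All graphs are finite, simple, undirected and connected, with n > 1 vertices; d_G denotes the distance in G. A *path-decomposition* of G = (V, E) is a finite sequence X_1, …, X_q of subsets of V (bags) that cover V, such that every edge of G has both ends in a common bag and X_i ∩ X_k ⊆ X_j whenever i ≤ j ≤ k. Its *length* is $\max_i \max_{u,v\in X_i} d_G(u,v)$; its *breadth* is the least r such that every bag is contained in a disk $\{w : d_G(c,w)\le r\}$ for some vertex c of G (not necessarily in the bag). The path-length pl(G) and the path-breadth pb(G) are the minimum length and the minimum breadth over all path-decompositions of G. An *asteroidal triple* is a set of three pairwise non-adjacent vertices such that each two of them are joined by a path that avoids the neighbourhood of the third; G is *AT-free* if it has no asteroidal triple. **Proposition.** 1. Every AT-free graph G satisfies $\mathrm{pb}(G)\le \mathrm{pl}(G)\le 2$. 2. There is an algorithm that, given (the adjacency matrix of) an n-vertex AT-free graph G, computes a path-decomposition of G of length at most 2, with at most n bags (output as a 0/1 bag–vertex incidence matrix), in $O(n^2)$ time on a unit-cost random access machine with words of $O(\log n)$ bits. 3. For a vertex s, an LBFS(s, G)-ordering is a bijection $\sigma: V\to\{1,\dots,n\}$ that arises by assigning the numbers n, n−1,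 …, 1 in this order, where s receives n and each further number is given to an un-numbered vertex whose label is lexicographically largest, the label of v being the decreasing list of the numbers of its already numbered neighbours. Let G be AT-free, let s be a vertex, let x be the vertex numbered 1 by an LBFS(s, G)-ordering, let σ be an LBFS(x, G)-ordering, and let $L_i=\{v : d_G(x,v)=i\}$. Let $G^+$ be the graph on V obtained from G by (a) making every two distinct vertices of a common layer $L_i$ adjacent, and (b) for every edge uv of G with $u,v\in L_i$ and σ(v) < σ(u), making u adjacent to every G-neighbour of v in $L_{i-1}$. Then $G\subseteq G^+\subseteq G^2$, where $G^2$ joins any two distinct vertices at distance at most 2 in G, and $G^+$ is an interval graph, that is, the intersection graph of closed intervals of the real line. -/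

import Mathlib

namespace ATFree

section Graphs

variable {V : Type*}

/-- Three pairwise distinct, pairwise non-adjacent vertices such that each two of them are joined
by a path that avoids the neighbourhood of the third. -/
def IsAsteroidalTriple (G : SimpleGraph V) (a b c : V) : Prop :=
  (a ≠ b ∧ b ≠ c ∧ a ≠ c) ∧ (¬ G.Adj a b ∧ ¬ G.Adj b c ∧ ¬ G.Adj a c) ∧
  (∃ p : G.Walk a b, p.IsPath ∧ ∀ w ∈ p.support, w ∉ G.neighborSet c) ∧
  (∃ p : G.Walk b c, p.IsPath ∧ ∀ w ∈ p.support, w ∉ G.neighborSet a) ∧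
  (∃ p : G.Walk a c, p.IsPath ∧ ∀ w ∈ p.support, w ∉ G.neighborSet b)

/-- `G` contains no asteroidal triple. -/
def IsATFree (G : SimpleGraph V) : Prop :=
  ∀ a b c : V, ¬ IsAsteroidalTriple G a b c

/-- A path-decomposition of `G`: a finite sequence of bags. -/
structure PathDecomposition (G : SimpleGraph V) where
  /-- the number of bags -/
  size : ℕ
  /-- the bags, in order -/
  bag : Fin size → Set V
  cover : ∀ v : V, ∃ i, v ∈ bag i
  edge : ∀ u v : V, G.Adj u v → ∃ i, u ∈ bag i ∧ v ∈ bag i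
  contiguous : ∀ i j k : Fin size, i ≤ j → j ≤ k → bag i ∩ bag k ⊆ bag j

/-- The length of a path-decomposition: the largest distance in `G` (not in the subgraph induced
by the bag) between two vertices of a common bag. -/
noncomputable def PathDecomposition.length {G : SimpleGraph V} (P : PathDecomposition G) : ℕ∞ :=
  ⨆ i, ⨆ u ∈ P.bag i, ⨆ v ∈ P.bag i, G.edist u v

/-- The breadth of a path-decomposition: the least `r` such that every bag lies in a disk of
radius `r` of `G`, whose centre need not belong to the bag. -/
noncomputable def PathDecomposition.breadth {G : SimpleGraph V} (P : PathDecomposition G) : ℕ∞ :=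
  sInf {r : ℕ∞ | ∀ i, ∃ c : V, ∀ w ∈ P.bag i, G.edist c w ≤ r}

/-- The path-length of `G` (the infimum is attained, as `ℕ∞` is well-ordered and the sequence
whose only bag is the set of all vertices is a path-decomposition). -/
noncomputable def pathLength (G : SimpleGraph V) : ℕ∞ :=
  ⨅ P : PathDecomposition G, P.length

/-- The path-breadth of `G`. -/
noncomputable def pathBreadth (G : SimpleGraph V) : ℕ∞ :=
  ⨅ P : PathDecomposition G, P.breadth

/-- `G` is the intersection graph of closed intervals of the real line. -/
def IsIntervalGraph (G : SimpleGraph V) : Prop :=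
  ∃ l r : V → ℝ, (∀ v, l v ≤ r v) ∧
    ∀ u v, u ≠ v → (G.Adj u v ↔ (Set.Icc (l u) (r u) ∩ Set.Icc (l v) (r v)).Nonempty)

/-- The square of `G`: distinct vertices are adjacent iff they are at distance at most two. -/
def square (G : SimpleGraph V) : SimpleGraph V where
  Adj u v := u ≠ v ∧ G.edist u v ≤ 2
  symm := ⟨fun u v h => ⟨h.1.symm, by rw [SimpleGraph.edist_comm]; exact h.2⟩⟩
  loopless := ⟨fun _ h => h.1 rfl⟩

open Classical in
/-- The label of `v` just before the number `k` is assigned, in a search that hands out the numbers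
`σ` from the largest to the smallest: the numbers larger than `k` carried by neighbours
of `v`, in the order in which they were assigned, that is, decreasingly. -/
noncomputable def label [Fintype V] (G : SimpleGraph V) (σ : V → ℕ) (k : ℕ) (v : V) : List ℕ :=
  (((Finset.univ : Finset V).filter (fun w => G.Adj v w ∧ k < σ w)).image σ).sort (· ≥ ·)

/-- `σ` is an ordering produced by a lexicographic breadth-first search from `s`: the numbers
`n, n - 1, …, 1` are assigned in this order, `s` receives `n`, and the vertex `v` that receives
a number has, among all vertices `u` not numbered before, a lexicographically largest label. -/
def IsLBFSOrdering [Fintype V] (G : SimpleGraph V) (s : V) (σ : V → ℕ) : Prop :=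
  Set.BijOn σ Set.univ (Set.Icc 1 (Fintype.card V)) ∧
  σ s = Fintype.card V ∧
  ∀ v u : V, σ u ≤ σ v →
    ¬ List.Lex (· < ·) (label G σ (σ v) v) (label G σ (σ v) u)

/-- The graph `G⁺`, with respect to the layers `{v | dist x v = i}` and to the ordering `σ`: the
edges of `G`; an edge between any two vertices of a common layer; and, for every edge
`u v` of `G` inside a layer with `σ v < σ u`, the edges from `u` to the neighbours `w` of `v` in
the previous layer. (`fromRel` symmetrizes the relation and removes loops.) -/
def plusGraph (G : SimpleGraph V) (x : V) (σ : V → ℕ) : SimpleGraph V :=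
  SimpleGraph.fromRel fun u w =>
    G.Adj u w ∨ G.dist x u = G.dist x w ∨
      ∃ v, G.Adj u v ∧ G.dist x u = G.dist x v ∧ σ v < σ u ∧
        G.Adj v w ∧ G.dist x w + 1 = G.dist x v

end Graphs

/-! A random access machine with unit cost and bounded words. It has registers and a memory,
both indexed by the natural numbers, and is programmed by structured programs. A program
mentions finitely many registers. -/

/-- The arithmetic operations (subtraction is truncated at zero). -/
inductive ArithOp
  | add
  | sub
  | mul

/-- The value of an arithmetic operation. -/
def ArithOp.eval : ArithOp → ℕ → ℕ → ℕ
  | .add, a, b => a + b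
  | .sub, a, b => a - b
  | .mul, a, b => a * b

/-- Programs. -/
inductive Prog
  /-- do nothing -/
  | skip
  /-- `R[d] := c` -/
  | const (d c : ℕ)
  /-- `R[d] := R[a] o R[b]` -/
  | arith (o : ArithOp) (d a b : ℕ)
  /-- `R[d] := M[R[a]]` -/
  | load (d a : ℕ)
  /-- `M[R[a]] := R[b]` -/
  | store (a b : ℕ)
  /-- first `p`, then `q` -/
  | seq (p q : Prog)
  /-- if `R[a] < R[b]` then `p` else `q` -/
  | branch (a b : ℕ) (p q : Prog)
  /-- while `R[a] < R[b]` do `p` -/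
  | loop (a b : ℕ) (p : Prog)

/-- The contents of the registers and of the memory. -/
structure State where
  reg : ℕ → ℕ
  mem : ℕ → ℕ

/-- Write `x` into register `d`. -/
def State.setReg (s : State) (d x : ℕ) : State := { s with reg := Function.update s.reg d x }

/-- Write `x` into memory cell `a`. -/
def State.setMem (s : State) (a x : ℕ) : State := { s with mem := Function.update s.mem a x }

/-- `Exec W p s t c`: on a machine whose words hold the numbers `0, …, W - 1`, the program `p`
started in state `s` halts in state `t` after exactly `c` steps. Every elementary instruction and
every evaluation of a test is one step. A program that tries to write a number that does not fit
into a word crashes: it has no execution. -/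
inductive Exec (W : ℕ) : Prog → State → State → ℕ → Prop
  | skip (s : State) : Exec W .skip s s 1
  | const (s : State) (d c : ℕ) (h : c < W) : Exec W (.const d c) s (s.setReg d c) 1
  | arith (s : State) (o : ArithOp) (d a b : ℕ) (h : o.eval (s.reg a) (s.reg b) < W) :
      Exec W (.arith o d a b) s (s.setReg d (o.eval (s.reg a) (s.reg b))) 1
  | load (s : State) (d a : ℕ) (h : s.mem (s.reg a) < W) :
      Exec W (.load d a) s (s.setReg d (s.mem (s.reg a))) 1
  | store (s : State) (a b : ℕ) (h : s.reg b < W) :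
      Exec W (.store a b) s (s.setMem (s.reg a) (s.reg b)) 1
  | seq {p q : Prog} {s t u : State} {c c' : ℕ} (hp : Exec W p s t c) (hq : Exec W q t u c') :
      Exec W (.seq p q) s u (c + c')
  | branch_true {a b : ℕ} {p q : Prog} {s t : State} {c : ℕ} (h : s.reg a < s.reg b)
      (hp : Exec W p s t c) : Exec W (.branch a b p q) s t (c + 1)
  | branch_false {a b : ℕ} {p q : Prog} {s t : State} {c : ℕ} (h : ¬ s.reg a < s.reg b)
      (hq : Exec W q s t c) : Exec W (.branch a b p q) s t (c + 1)
  | loop_done {a b : ℕ} {p : Prog} {s : State} (h : ¬ s.reg a < s.reg b) :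
      Exec W (.loop a b p) s s 1
  | loop_step {a b : ℕ} {p : Prog} {s t u : State} {c c' : ℕ} (h : s.reg a < s.reg b)
      (hp : Exec W p s t c) (hl : Exec W (.loop a b p) t u c') :
      Exec W (.loop a b p) s u (c + c' + 1)

open Classical in
/-- The initial state for a graph on the vertices `0, …, n - 1`: register `0` holds `n`, the
memory cells `0, …, n * n - 1` hold the adjacency matrix row by row, everything else is `0`. -/
noncomputable def inputState {n : ℕ} (G : SimpleGraph (Fin n)) : State where
  reg := fun r => if r = 0 then n else 0
  mem := fun a => if ∃ i j : Fin n, a = i * n + j ∧ G.Adj i j then 1 else 0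

/-- The state `t` holds the path-decomposition `P`: register `1` holds the number of bags, at most
`n`, and register `2` the address of a 0/1-matrix, stored row by row, whose `i`-th row is the
indicator vector of the `i`-th bag. -/
def State.Holds (t : State) {n : ℕ} {G : SimpleGraph (Fin n)} (P : PathDecomposition G) : Prop :=
  P.size ≤ n ∧ t.reg 1 = P.size ∧
  ∀ (i : Fin P.size) (v : Fin n),
    (v ∈ P.bag i → t.mem (t.reg 2 + i * n + v) = 1) ∧
    (v ∉ P.bag i → t.mem (t.reg 2 + i * n + v) = 0)

end ATFree

/-! Everything rests on one vertex order. Lexicographic searches enter only through the four-point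
condition `IsLexOrder`. In an AT-free graph the last vertex `x` of such a search is admissible
(`isAdmissible_last`): two vertices `u`, `v` unrelated with respect to `x` either form an asteroidal
triple with `x`, or lie in different components of `G` minus the closed neighbourhood of `x`. In the
second case the search meets one component first, and any exit from it passes through neighbours of
all vertices of the other.

A second search, started at `x`, respects the distance layers. Admissibility makes neighbourhoods
nested (`IsAdmissibleOrder.adj_of_adj`): if `u` precedes a non-adjacent `v` in the same layer, every
neighbour of `v` in the previous layer is a neighbour of `u`. Otherwise the four-point condition
would make `u` and `v` unrelated. So layers have diameter at most two, and letting each vertex live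
from its own position to the last position in its closed neighbourhood gives a path-decomposition of
length at most two.

Nesting also shows that `G⁺` joins `a` to a later `c` exactly when they share a layer, or `a` lies
one layer below and has a neighbour in the layer of `c` at or after `c` (`plusGraph_adj_iff`). This
property passes to every vertex between `a` and `c`, which makes the order an interval order.

For the algorithm, labels are replaced by ranks below `n`. After a visit to `b` the rank `r v`
becomes the key `2 * r v + [b ~ v]`, and keys are compressed by counting the distinct smaller ones.
This takes linear time per visit, so two searches and the output of the bags are quadratic. The same
rank invariant proves, without the machine, that searches exist, hence the bound on path-length. -/

namespace ATFree

/-! ### Lexicographic orders and the admissibility of the last vertex -/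

section LexOrders

variable {V : Type*} {G : SimpleGraph V}

/-- The four-point condition that characterizes lexicographic breadth-first searches, for the
positions `p` at which the vertices are visited. -/
def IsLexOrder (G : SimpleGraph V) (p : V → ℕ) : Prop :=
  ∀ u v w : V, p v < p u → p w < p v → G.Adj w u → ¬ G.Adj w v →
    ∃ w', p w' < p w ∧ G.Adj w' v ∧ ¬ G.Adj w' u

/-- If at each choice of a vertex `v` no vertex `u` that comes later wins at the first place where
the two differ, then the four-point condition holds. -/
theorem isLexOrder_of_no_witness {p : V → ℕ}
    (h : ∀ u v w : V, p v < p u → p w < p v → G.Adj w u → ¬ G.Adj w v →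
      ¬ ∀ w', p w' < p w → (G.Adj w' u ↔ G.Adj w' v)) : IsLexOrder G p := by
  intro u v w hvu hwv hwu hnwv
  -- An earlier place of difference either favours `v` and is the required witness, or favours `u`
  -- and replaces `w`.
  induction hk : p w using Nat.strong_induction_on generalizing w with
  | _ k ih =>
    subst hk
    have := h u v w hvu hwv hwu hnwv
    push Not at this
    obtain ⟨w', hw', hd⟩ := this
    rcases hd with ⟨h1, h2⟩ | ⟨h1, h2⟩
    · obtain ⟨z, hz, hz'⟩ := ih (p w') hw' w' (hw'.trans hwv) h1 h2 rfl
      exact ⟨z, hz.trans hw', hz'⟩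
    · exact ⟨w', hw', h2, h1⟩

/-- `a` and `b` are joined by a walk that avoids the neighbourhood of `c`. -/
def Avoids (G : SimpleGraph V) (c a b : V) : Prop :=
  ∃ q : G.Walk a b, ∀ w ∈ q.support, ¬ G.Adj c w

theorem Avoids.refl {c a : V} (h : ¬ G.Adj c a) : Avoids G c a a := ⟨.nil, by simpa using h⟩

theorem Avoids.symm {c a b : V} (h : Avoids G c a b) : Avoids G c b a := by
  obtain ⟨q, hq⟩ := h
  exact ⟨q.reverse, by simpa using hq⟩

theorem Avoids.trans {c a b d : V} (h : Avoids G c a b) (h' : Avoids G c b d) :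
    Avoids G c a d := by
  obtain ⟨q, hq⟩ := h
  obtain ⟨q', hq'⟩ := h'
  refine ⟨q.append q', fun w hw => ?_⟩
  rcases (SimpleGraph.Walk.mem_support_append_iff _ _).1 hw with h | h
  exacts [hq w h, hq' w h]

theorem Avoids.left {c a b : V} (h : Avoids G c a b) : ¬ G.Adj c a :=
  h.choose_spec a (by simp)

theorem Avoids.right {c a b : V} (h : Avoids G c a b) : ¬ G.Adj c b :=
  h.choose_spec b (by simp)

theorem Avoids.of_adj {c a b : V} (h : G.Adj a b) (ha : ¬ G.Adj c a) (hb : ¬ G.Adj c b) :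
    Avoids G c a b :=
  ⟨h.toWalk, by simp [SimpleGraph.Adj.toWalk, ha, hb]⟩

theorem Avoids.exists_path {c a b : V} (h : Avoids G c a b) :
    ∃ q : G.Walk a b, q.IsPath ∧ ∀ w ∈ q.support, w ∉ G.neighborSet c := by
  classical
  obtain ⟨q, hq⟩ := h
  exact ⟨q.bypass, q.bypass_isPath, fun w hw => hq w (q.support_bypass_subset_support hw)⟩

/-- A vertex `x` is admissible if no two other vertices are unrelated with respect to it. -/
def IsAdmissible (G : SimpleGraph V) (x : V) : Prop :=
  ∀ u v : V, u ≠ x → v ≠ x → u ≠ v → Avoids G v u x → ¬ Avoids G u v x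

/-- If two components of `G` minus the closed neighbourhood of the last vertex `x` start in
the order `c₁`, `c₂`, then the vertices by which one leaves the first component are adjacent to all
vertices of the second. -/
theorem not_avoids_of_component_lt {p : V → ℕ} (hp : IsLexOrder G p)
    (hinj : Function.Injective p) {x : V} (hx : ∀ y, p y ≤ p x) {u v c₁ c₂ : V}
    (hu : u ≠ x) (hv : v ≠ x) (huv : ¬ Avoids G x u v)
    (h₁ : Avoids G x u c₁) (h₂ : Avoids G x v c₂)
    (hmin : ∀ y, Avoids G x v y → p c₂ ≤ p y) (hlt : p c₁ < p c₂) : ¬ Avoids G v u x := by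
  -- `Avoids` does not forbid the walk to meet `x` itself, but a walk that starts elsewhere could
  -- enter `x` only through a neighbour of `x`. So `Avoids G x` describes the components left by the
  -- closed neighbourhood.
  have ne_x : ∀ {y a : V}, Avoids G x a y → a ≠ x → y ≠ x := by
    rintro y a ⟨q, hq⟩ ha rfl
    obtain ⟨z, hz, q', he⟩ := SimpleGraph.Walk.exists_eq_cons_of_ne (Ne.symm ha) q.reverse
    refine hq z ?_ hz
    have : z ∈ q.reverse.support := by simp [he]
    simpa using this
  have hc₂x : c₂ ≠ x := ne_x h₂ hv
  have lt_x : ∀ {y}, y ≠ x → p y < p x := fun hy => lt_of_le_of_ne (hx _) (fun e => hy (hinj e))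
  -- the earlier neighbours of `c₂` are the earlier neighbours of `x`
  have nbr : ∀ z, p z < p c₂ → G.Adj z c₂ → G.Adj z x := by
    intro z hz hzc
    by_contra hzx
    exact (hmin z (h₂.trans (.of_adj hzc.symm h₂.right (fun h => hzx h.symm)))).not_gt hz
  have nbr' : ∀ z, p z < p c₂ → G.Adj z x → G.Adj z c₂ := by
    intro z hz hzx
    by_contra hzc
    obtain ⟨w, hw, hwc, hwx⟩ := hp x c₂ z (lt_x hc₂x) hz hzx hzc
    exact hwx (nbr w (hw.trans hz) hwc)
  -- Of the vertices visited before `c₂`, anything after `c₂` sees only neighbours of `x`. A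
  -- counterexample `z` produces an earlier one: compare `t` with `c₂`, then `x` with `t`.
  have later : ∀ z t, p c₂ < p t → p z < p c₂ → G.Adj z t → G.Adj z x := by
    intro z t ht hz hzt
    induction hk : p z using Nat.strong_induction_on generalizing z with
    | _ k ih =>
      subst hk
      by_contra hzx
      have htx : t ≠ x := by rintro rfl; exact hzx hzt
      obtain ⟨z', hz', hzc', hzt'⟩ := hp t c₂ z ht hz hzt (fun h => hzx (nbr z hz h))
      obtain ⟨y, hy, hyt, hyx⟩ := hp x t z' (lt_x htx) ((hz'.trans hz).trans ht)
        (nbr z' (hz'.trans hz) hzc') hzt'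
      exact hyx (ih (p y) (hy.trans hz') y (hy.trans (hz'.trans hz)) hyt rfl)
  -- Conversely, anything after `c₂` sees all neighbours of `x` visited before `c₂`.
  have later' : ∀ z t, p c₂ < p t → p z < p c₂ → G.Adj z x → G.Adj z t := by
    intro z t ht hz hzx
    by_contra hzt
    have htx : t ≠ x := by rintro rfl; exact hzt hzx
    obtain ⟨y, hy, hyt, hyx⟩ := hp x t z (lt_x htx) (hz.trans ht) hzx hzt
    exact hyx (later y t ht (hy.trans hz) hyt)
  -- the first component is visited before `c₂`
  have before : ∀ y, Avoids G x u y → p y < p c₂ := by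
    intro y hy
    obtain ⟨q, hq⟩ := h₁.symm.trans hy
    by_contra hyc
    obtain ⟨d, hd, hd1, hd2⟩ := q.exists_boundary_dart {z | p z < p c₂} hlt hyc
    have hds := SimpleGraph.Walk.dart_fst_mem_support_of_mem_darts q hd
    have hds' := SimpleGraph.Walk.dart_snd_mem_support_of_mem_darts q hd
    simp only [Set.mem_ofPred_eq, not_lt] at hd1 hd2
    rcases hd2.eq_or_lt with he | hl
    · exact hq _ hds (nbr _ hd1 (hinj he ▸ d.adj)).symm
    · exact hq _ hds (later _ _ hl hd1 d.adj).symm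
  -- The first vertex of the walk outside the component of `u` is a neighbour of `x` visited before
  -- `c₂`, so it is adjacent to `v`, which is `c₂` or comes later.
  rintro ⟨q, hq⟩
  have hux : Avoids G x u u := .refl h₁.left
  have hxC : ¬ Avoids G x u x := fun h => ne_x h hu rfl
  obtain ⟨d, hd, hd1, hd2⟩ := q.exists_boundary_dart {z | Avoids G x u z} hux hxC
  have hds' := SimpleGraph.Walk.dart_snd_mem_support_of_mem_darts q hd
  simp only [Set.mem_ofPred_eq] at hd1 hd2
  have hadj : G.Adj x d.snd := by
    by_contra h
    exact hd2 (hd1.trans (.of_adj d.adj hd1.right h))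
  have hlt' : p d.snd < p c₂ := by
    by_contra h
    rcases (not_lt.1 h).eq_or_lt with he | hl
    · exact h₂.right (hinj he ▸ hadj)
    · exact hd1.right (later _ _ hl (before _ hd1) d.adj).symm
  refine hq _ hds' ?_
  rcases (hmin v (.refl h₂.left)).eq_or_lt with he | hl
  · exact hinj he ▸ (nbr' _ hlt' hadj.symm).symm
  · exact (later' _ _ hl hlt' hadj.symm).symm

/-- The two walks to `x` complete an asteroidal triple if `u` and `v` share a component. If not,
compare the first visited vertices `c₁`, `c₂` of their components. -/
theorem isAdmissible_last {p : V → ℕ} (hG : IsATFree G) (hp : IsLexOrder G p)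
    (hinj : Function.Injective p) {x : V} (hx : ∀ y, p y ≤ p x) : IsAdmissible G x := by
  intro u v hu hv huv h1 h2
  have hxu : ¬ G.Adj x u := fun h => h2.right h.symm
  have hxv : ¬ G.Adj x v := fun h => h1.right h.symm
  by_cases hC : Avoids G x u v
  · exact hG u v x ⟨⟨huv, hv, hu⟩, ⟨fun h => h1.left h.symm, fun h => hxv h.symm,
      fun h => hxu h.symm⟩, hC.exists_path, h2.exists_path, h1.exists_path⟩
  have first : ∀ a, ¬ G.Adj x a → ∃ c, Avoids G x a c ∧ ∀ y, Avoids G x a y → p c ≤ p y := by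
    intro a ha
    obtain ⟨c, hc, hm⟩ := WellFounded.has_min (measure p).wf {y | Avoids G x a y} ⟨a, .refl ha⟩
    exact ⟨c, hc, fun y hy => not_lt.1 (hm y hy)⟩
  obtain ⟨c₁, hc₁, hm₁⟩ := first u hxu
  obtain ⟨c₂, hc₂, hm₂⟩ := first v hxv
  rcases lt_trichotomy (p c₁) (p c₂) with h | h | h
  · exact not_avoids_of_component_lt hp hinj hx hu hv hC hc₁ hc₂ hm₂ h h1
  · exact hC (hc₁.trans (hinj h ▸ hc₂.symm))
  · exact not_avoids_of_component_lt hp hinj hx hv hu (fun h => hC h.symm) hc₂ hc₁ hm₁ h h2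

/-! ### Distance layers and the path-decomposition of length two -/

theorem exists_adj_dist_succ (hG : G.Connected) {x b : V} (hb : b ≠ x) :
    ∃ a, G.Adj b a ∧ G.dist x a + 1 = G.dist x b := by
  obtain ⟨q, hq⟩ := hG.exists_walk_length_eq_dist b x
  obtain ⟨a, ha, q', rfl⟩ := SimpleGraph.Walk.exists_eq_cons_of_ne hb q
  refine ⟨a, ha, ?_⟩
  have h1 := SimpleGraph.dist_le q'
  have h2 := hG.dist_triangle (u := b) (v := a) (w := x)
  rw [SimpleGraph.dist_eq_one_iff_adj.2 ha] at h2
  rw [SimpleGraph.Walk.length_cons] at hq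
  rw [SimpleGraph.dist_comm (u := x), SimpleGraph.dist_comm (u := x)]
  omega

theorem dist_le_succ_of_adj (hG : G.Connected) (x : V) {a b : V} (h : G.Adj a b) :
    G.dist x a ≤ G.dist x b + 1 := by
  have := hG.dist_triangle (u := x) (v := b) (w := a)
  rwa [SimpleGraph.dist_eq_one_iff_adj.2 h.symm] at this

/-- The order of a lexicographic search from `x` refines the distance from `x`. -/
theorem dist_le_of_lt {p : V → ℕ} (hG : G.Connected) (hp : IsLexOrder G p)
    (hinj : Function.Injective p) {x : V} (hx : ∀ y, p x ≤ p y) {a b : V} (hab : p a < p b) :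
    G.dist x a ≤ G.dist x b := by
  induction hk : p a using Nat.strong_induction_on generalizing a b with
  | _ k ih =>
  subst hk
  induction hd : G.dist x b using Nat.strong_induction_on generalizing b with
  | _ d ih' =>
  subst hd
  have hbx : b ≠ x := by rintro rfl; exact (hx a).not_gt hab
  obtain ⟨b', hb', hdb⟩ := exists_adj_dist_succ hG hbx
  rcases lt_trichotomy (p a) (p b') with h | h | h
  · exact (ih' _ (by omega) h rfl).trans (by omega)
  · rw [hinj h]; omega
  · obtain ⟨c, hc, hca⟩ : ∃ c, p c ≤ p b' ∧ G.Adj c a := by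
      by_cases hba : G.Adj b' a
      · exact ⟨b', le_rfl, hba⟩
      · obtain ⟨w, hw, hwa, -⟩ := hp b a b' hab h hb'.symm hba
        exact ⟨w, hw.le, hwa⟩
    have h1 : G.dist x c ≤ G.dist x b' := by
      rcases hc.eq_or_lt with he | hl
      · rw [hinj he]
      · exact ih (p c) (hl.trans h) hl rfl
    have := dist_le_succ_of_adj hG x hca.symm
    omega

theorem exists_walk_dist_lt (hG : G.Connected) (x w : V) :
    ∃ q : G.Walk w x, ∀ z ∈ q.support, z = w ∨ G.dist x z < G.dist x w := by
  induction hk : G.dist x w using Nat.strong_induction_on generalizing w with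
  | _ k ih =>
  subst hk
  by_cases hw : w = x
  · subst hw; exact ⟨.nil, by simp⟩
  obtain ⟨a, ha, hd⟩ := exists_adj_dist_succ hG hw
  obtain ⟨q, hq⟩ := ih _ (by omega) a rfl
  refine ⟨.cons ha q, fun z hz => ?_⟩
  rw [SimpleGraph.Walk.support_cons, List.mem_cons] at hz
  rcases hz with h | h
  · exact .inl h
  · rcases hq z h with rfl | h
    · right; omega
    · right; omega

/-- A walk that steps down from `u` to `a` and then approaches `x` avoids the neighbourhood of `v`,
if `v` is farther away from `x` than `a`. -/
theorem avoids_of_dist_lt (hG : G.Connected) {x u v a : V} (huv : ¬ G.Adj v u) (hua : G.Adj u a)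
    (hva : ¬ G.Adj v a) (h : G.dist x a < G.dist x v) : Avoids G v u x := by
  obtain ⟨q, hq⟩ := exists_walk_dist_lt hG x a
  refine ⟨.cons hua q, fun z hz hvz => ?_⟩
  rw [SimpleGraph.Walk.support_cons, List.mem_cons] at hz
  rcases hz with rfl | hz
  · exact huv hvz
  · rcases hq z hz with rfl | h'
    · exact hva hvz
    · have := dist_le_succ_of_adj hG x hvz
      omega

/-- An order of a lexicographic search that starts at an admissible vertex `x`. -/
structure IsAdmissibleOrder (G : SimpleGraph V) (x : V) (p : V → ℕ) : Prop where
  lex : IsLexOrder G p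
  injective : Function.Injective p
  start_le : ∀ y, p x ≤ p y
  admissible : IsAdmissible G x

theorem IsAdmissibleOrder.dist_le {x : V} {p : V → ℕ} (h : IsAdmissibleOrder G x p)
    (hG : G.Connected) {a c : V} (hac : p a ≤ p c) : G.dist x a ≤ G.dist x c := by
  rcases hac.eq_or_lt with he | hl
  · rw [h.injective he]
  · exact dist_le_of_lt hG h.lex h.injective h.start_le hl

/-- Non-adjacent vertices of a layer have nested neighbourhoods in the previous layer. -/
theorem IsAdmissibleOrder.adj_of_adj {x : V} {p : V → ℕ} (h : IsAdmissibleOrder G x p)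
    (hG : G.Connected) {u v b : V} (hd : G.dist x u = G.dist x v) (huv : ¬ G.Adj u v)
    (hlt : p u < p v) (hvb : G.Adj v b) (hb : G.dist x b < G.dist x v) : G.Adj u b := by
  by_contra hub
  have hbu : p b < p u := by
    by_contra hn
    have := h.dist_le hG (not_lt.1 hn)
    omega
  -- `w` is no farther from `x` than `b`, so descending from `u` through `w` and from `v` through
  -- `b` gives walks that make `u` and `v` unrelated.
  obtain ⟨w, hw, hwu, hwv⟩ := h.lex v u b hlt hbu hvb.symm (fun e => hub e.symm)
  have hwd := h.dist_le hG hw.le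
  have ne : ∀ {a}, G.dist x b < G.dist x a → a ≠ x := by
    rintro a ha rfl
    simp at ha
  exact h.admissible u v (ne (hd ▸ hb)) (ne hb) (by rintro rfl; omega)
    (avoids_of_dist_lt hG (fun e => huv e.symm) hwu.symm (fun e => hwv e.symm) (by omega))
    (avoids_of_dist_lt hG huv hvb hub (by omega))

theorem edist_le_two_of_adj {a b c : V} (h : G.Adj a b) (h' : G.Adj b c) : G.edist a c ≤ 2 := by
  simpa using SimpleGraph.edist_le (.cons h (.cons h' .nil) : G.Walk a c)

theorem edist_le_two_of_adj' {a b : V} (h : G.Adj a b) : G.edist a b ≤ 2 :=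
  (SimpleGraph.edist_eq_one_iff_adj.2 h).le.trans (by norm_num)

/-- By nesting, a neighbour of the later vertex in the previous layer is a common neighbour. -/
theorem IsAdmissibleOrder.edist_le_two_of_lt {x : V} {p : V → ℕ} (h : IsAdmissibleOrder G x p)
    (hG : G.Connected) {u v : V} (hd : G.dist x u = G.dist x v) (hlt : p u < p v) :
    G.edist u v ≤ 2 := by
  by_cases huv : G.Adj u v
  · exact edist_le_two_of_adj' huv
  have hvx : v ≠ x := by rintro rfl; exact (h.start_le u).not_gt hlt
  obtain ⟨b, hvb, hb⟩ := exists_adj_dist_succ hG hvx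
  exact edist_le_two_of_adj (h.adj_of_adj hG hd huv hlt hvb (by omega)) hvb.symm

/-- Two vertices of a layer have distance at most two. -/
theorem IsAdmissibleOrder.edist_le_two {x : V} {p : V → ℕ} (h : IsAdmissibleOrder G x p)
    (hG : G.Connected) {u v : V} (hd : G.dist x u = G.dist x v) : G.edist u v ≤ 2 := by
  rcases lt_trichotomy (p u) (p v) with hlt | he | hlt
  · exact h.edist_le_two_of_lt hG hd hlt
  · simp [h.injective he]
  · rw [SimpleGraph.edist_comm]
    exact h.edist_le_two_of_lt hG hd.symm hlt

/-- The path-decomposition in which `w` occupies the bags from `p w` to the last position of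
a vertex of its closed neighbourhood. -/
def spanDecomposition (G : SimpleGraph V) (p : V → ℕ) (n : ℕ) (hn : ∀ v, p v < n) :
    PathDecomposition G where
  size := n
  bag j := {w | p w ≤ j ∧ (j ≤ p w ∨ ∃ v, G.Adj w v ∧ j ≤ p v)}
  cover v := ⟨⟨p v, hn v⟩, le_rfl, .inl le_rfl⟩
  edge u v h := by
    rcases le_total (p u) (p v) with hle | hle
    · exact ⟨⟨p v, hn v⟩, ⟨hle, .inr ⟨v, h, le_rfl⟩⟩, le_rfl, .inl le_rfl⟩
    · exact ⟨⟨p u, hn u⟩, ⟨le_rfl, .inl le_rfl⟩, hle, .inr ⟨u, h.symm, le_rfl⟩⟩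
  contiguous := by
    rintro i j k hij hjk w ⟨⟨hi, -⟩, -, hk⟩
    rw [Fin.le_def] at hij hjk
    exact ⟨hi.trans hij, hk.imp hjk.trans fun ⟨v, hv, hkv⟩ => ⟨v, hv, hjk.trans hkv⟩⟩

/-- The neighbour `v` keeps `w` in bag `j`, and `w'` lies between `w` and `v` in the order. If `w'`
is not in the layer of `w`, it is in that of `v`, one further out. Then `w'` is equal or adjacent to
`v`, or nesting makes it adjacent to `w`. -/
theorem IsAdmissibleOrder.edist_le_two_of_mem_span {x : V} {p : V → ℕ}
    (h : IsAdmissibleOrder G x p) (hG : G.Connected) {w w' v : V} {j : ℕ} (hlt : p w < p w')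
    (hj : p w' ≤ j) (hv : G.Adj w v) (hjv : j ≤ p v) : G.edist w w' ≤ 2 := by
  have h1 := h.dist_le hG hlt.le
  have h2 := h.dist_le hG (hj.trans hjv)
  have h3 := dist_le_succ_of_adj hG x hv.symm
  by_cases he : G.dist x w = G.dist x w'
  · exact h.edist_le_two hG he
  rcases (hj.trans hjv).eq_or_lt with hp | hp
  · rw [h.injective hp]
    exact edist_le_two_of_adj' hv
  by_cases hadj : G.Adj w' v
  · exact edist_le_two_of_adj hv hadj.symm
  · exact edist_le_two_of_adj'
      (h.adj_of_adj hG (by omega) hadj hp hv.symm (by omega)).symm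

theorem IsAdmissibleOrder.length_spanDecomposition_le {x : V} {p : V → ℕ}
    (h : IsAdmissibleOrder G x p) (hG : G.Connected) (n : ℕ) (hn : ∀ v, p v < n) :
    (spanDecomposition G p n hn).length ≤ 2 := by
  have key : ∀ w w' : V, ∀ j : ℕ, p w < p w' → (j ≤ p w ∨ ∃ v, G.Adj w v ∧ j ≤ p v) → p w' ≤ j →
      G.edist w w' ≤ 2 := by
    rintro w w' j hlt (hj | ⟨v, hv, hjv⟩) hj'
    · omega
    · exact h.edist_le_two_of_mem_span hG hlt hj' hv hjv
  refine iSup_le fun j => iSup₂_le fun w hw => iSup₂_le fun w' hw' => ?_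
  rcases lt_trichotomy (p w) (p w') with hlt | he | hlt
  · exact key w w' j hlt hw.2 hw'.1
  · simp [h.injective he]
  · rw [SimpleGraph.edist_comm]
    exact key w' w j hlt hw'.2 hw.1

/-- Any vertex of a bag serves as its centre; `Nonempty V` supplies a centre for empty bags. -/
theorem pathBreadth_le_pathLength [Nonempty V] (G : SimpleGraph V) :
    pathBreadth G ≤ pathLength G := by
  refine iInf_mono fun P => sInf_le fun i => ?_
  rcases (P.bag i).eq_empty_or_nonempty with he | ⟨c, hc⟩
  · exact ⟨Classical.arbitrary V, by simp [he]⟩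
  · refine ⟨c, fun w hw => ?_⟩
    exact (le_iSup₂_of_le (f := fun v _ => G.edist c v) w hw le_rfl).trans
      ((le_iSup₂_of_le (f := fun u _ => ⨆ v ∈ P.bag i, G.edist u v) c hc le_rfl).trans
        (le_iSup (fun i => ⨆ u ∈ P.bag i, ⨆ v ∈ P.bag i, G.edist u v) i))

/-- An order in which every vertex is joined to all vertices that precede some later neighbour
is the order of the left ends of intervals that represent the graph. -/
theorem isIntervalGraph_of_order [Finite V] (H : SimpleGraph V) (p : V → ℕ)
    (hinj : Function.Injective p)
    (h : ∀ a b c, p a < p b → p b < p c → H.Adj a c → H.Adj a b) : IsIntervalGraph H := by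
  classical
  cases nonempty_fintype V
  -- The right end of the interval: the last position in the closed neighbourhood of `a`.
  let e : V → ℕ := fun a => (Finset.univ.filter fun c => c = a ∨ H.Adj a c).sup p
  have le_e : ∀ {a c}, c = a ∨ H.Adj a c → p c ≤ e a := fun {a c} hc =>
    Finset.le_sup (f := p) (Finset.mem_filter.2 ⟨Finset.mem_univ _, hc⟩)
  have key : ∀ a b, p a < p b → (H.Adj a b ↔ p b ≤ e a) := by
    intro a b hab
    refine ⟨fun hadj => le_e (.inr hadj), fun hle => ?_⟩
    obtain ⟨c, hc, he⟩ := Finset.exists_mem_eq_sup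
      (Finset.univ.filter fun c => c = a ∨ H.Adj a c) ⟨a, by simp⟩ p
    change e a = p c at he
    rw [he] at hle
    rcases (Finset.mem_filter.1 hc).2 with rfl | hac
    · omega
    · rcases hle.eq_or_lt with h' | h'
      · rwa [hinj h']
      · exact h a b c hab h' hac
  refine ⟨fun a => p a, fun a => e a, fun a => Nat.cast_le.2 (le_e (.inl rfl)), ?_⟩
  have key' : ∀ a b, p a < p b →
      (H.Adj a b ↔ (Set.Icc (p a : ℝ) (e a) ∩ Set.Icc (p b : ℝ) (e b)).Nonempty) := by
    intro a b hab
    rw [key a b hab]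
    constructor
    · intro hle
      refine ⟨p b, ⟨?_, ?_⟩, ⟨le_rfl, ?_⟩⟩
      · exact_mod_cast hab.le
      · exact_mod_cast hle
      · exact_mod_cast le_e (.inl rfl)
    · rintro ⟨z, hz, hz'⟩
      exact_mod_cast hz'.1.trans hz.2
  intro u v huv
  rcases lt_trichotomy (p u) (p v) with hlt | he | hlt
  · exact key' u v hlt
  · exact absurd (hinj he) huv
  · rw [H.adj_comm, Set.inter_comm]
    exact key' v u hlt

end LexOrders

/-! ### The graph `G⁺` is an interval graph between `G` and its square -/

section PlusGraph

variable {V : Type*} {G : SimpleGraph V}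

theorem plusGraph_le_square {x : V} {p : V → ℕ} (h : IsAdmissibleOrder G x p) (hG : G.Connected)
    (σ : V → ℕ) : plusGraph G x σ ≤ square G := by
  have key : ∀ u w, (G.Adj u w ∨ G.dist x u = G.dist x w ∨
      ∃ v, G.Adj u v ∧ G.dist x u = G.dist x v ∧ σ v < σ u ∧
        G.Adj v w ∧ G.dist x w + 1 = G.dist x v) → G.edist u w ≤ 2 := by
    rintro u w (h1 | h1 | ⟨v, h1, -, -, h2, -⟩)
    · exact edist_le_two_of_adj' h1
    · exact h.edist_le_two hG h1
    · exact edist_le_two_of_adj h1 h2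
  intro u w huw
  rw [plusGraph, SimpleGraph.fromRel_adj] at huw
  refine ⟨huw.1, ?_⟩
  rcases huw.2 with h1 | h1
  · exact key u w h1
  · rw [SimpleGraph.edist_comm]
    exact key w u h1

theorem le_plusGraph (x : V) (σ : V → ℕ) : G ≤ plusGraph G x σ := by
  intro u w huw
  rw [plusGraph, SimpleGraph.fromRel_adj]
  exact ⟨huw.ne, .inl (.inl huw)⟩

/-- Rule (b) needs `v` adjacent to `c`, but this can be dropped: if `v` is later and not adjacent to
`c`, nesting already gives the edge `a c` of `G`. What remains is monotone in `c`. -/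
theorem IsAdmissibleOrder.plusGraph_adj_iff {x : V} {p : V → ℕ} (h : IsAdmissibleOrder G x p)
    (hG : G.Connected) {σ : V → ℕ} (hσ : ∀ u v, σ v < σ u ↔ p u < p v) {a c : V}
    (hac : p a < p c) : (plusGraph G x σ).Adj a c ↔ G.dist x a = G.dist x c ∨
      G.dist x a + 1 = G.dist x c ∧ ∃ v, G.dist x v = G.dist x c ∧ p c ≤ p v ∧ G.Adj v a := by
  have hd := h.dist_le hG hac.le
  rw [plusGraph, SimpleGraph.fromRel_adj]
  constructor
  · rintro ⟨-, h'⟩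
    by_cases he : G.dist x a = G.dist x c
    · exact .inl he
    right
    have adj : G.Adj c a → G.dist x a + 1 = G.dist x c ∧
        ∃ v, G.dist x v = G.dist x c ∧ p c ≤ p v ∧ G.Adj v a := fun hadj =>
      ⟨by have := dist_le_succ_of_adj hG x hadj; omega, c, rfl, le_rfl, hadj⟩
    rcases h' with (h1 | h1 | ⟨v, -, h1, -, -, h2⟩) | (h1 | h1 | ⟨v, h1, h2, h3, h4, h5⟩)
    · exact adj h1.symm
    · exact absurd h1 he
    -- Rule (b) applied from `a` would put the later vertex `c` into an earlier layer.
    · omega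
    · exact adj h1
    · exact absurd h1.symm he
    · exact ⟨by omega, v, h2.symm, ((hσ _ _).1 h3).le, h4⟩
  · refine fun h' => ⟨by rintro rfl; omega, ?_⟩
    rcases h' with h' | ⟨h1, v, h2, h3, h4⟩
    · exact .inl (.inr (.inl h'))
    · right
      rcases h3.eq_or_lt with he | hl
      · rw [h.injective he]
        exact .inl h4
      · by_cases hcv : G.Adj c v
        · exact .inr (.inr ⟨v, hcv, h2.symm, (hσ _ _).2 hl, h4, by omega⟩)
        · exact .inl (h.adj_of_adj hG h2.symm hcv hl h4 (by omega))

theorem IsAdmissibleOrder.isIntervalGraph_plusGraph [Finite V] {x : V} {p : V → ℕ}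
    (h : IsAdmissibleOrder G x p) (hG : G.Connected) {σ : V → ℕ}
    (hσ : ∀ u v, σ v < σ u ↔ p u < p v) : IsIntervalGraph (plusGraph G x σ) := by
  refine isIntervalGraph_of_order _ p h.injective fun a b c hab hbc hac => ?_
  rw [h.plusGraph_adj_iff hG hσ (hab.trans hbc)] at hac
  rw [h.plusGraph_adj_iff hG hσ hab]
  have h1 := h.dist_le hG hab.le
  have h2 := h.dist_le hG hbc.le
  by_cases he : G.dist x a = G.dist x b
  · exact .inl he
  rcases hac with h' | ⟨h3, v, h4, h5, h6⟩
  · omega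
  -- Here `b` is in the layer of `c` and precedes it, so the witness `v` for `c` also serves `b`.
  · exact .inr ⟨by omega, v, by omega, hbc.le.trans h5, h6⟩

end PlusGraph

/-! ### From label maximality to the four-point condition -/

section Labels

/-- Decreasing lists are decided at the largest number on which they differ, here `m`. A larger head
in `l₁` would exceed `m`, hence occur in `l₂` above its own head. -/
theorem lex_of_sortedGT {l₁ l₂ : List ℕ} (h₁ : l₁.Pairwise (· > ·)) (h₂ : l₂.Pairwise (· > ·))
    {m : ℕ} (hm₁ : m ∉ l₁) (hm₂ : m ∈ l₂) (h : ∀ j, m < j → (j ∈ l₁ ↔ j ∈ l₂)) :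
    List.Lex (· < ·) l₁ l₂ := by
  induction l₁ generalizing l₂ with
  | nil =>
    cases l₂ with
    | nil => simp at hm₂
    | cons b l₂ => exact .nil
  | cons a l₁ ih =>
    cases l₂ with
    | nil => simp at hm₂
    | cons b l₂ =>
      rw [List.pairwise_cons] at h₁ h₂
      simp only [List.mem_cons, not_or] at hm₁ hm₂ h
      rcases lt_trichotomy a b with hab | rfl | hab
      · exact .rel hab
      · refine .cons (ih h₁.2 h₂.2 hm₁.2 (hm₂.resolve_left hm₁.1) fun j hj => ?_)
        have := h j hj
        constructor
        · intro hj'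
          exact (this.1 (.inr hj')).resolve_left (h₁.1 j hj').ne
        · intro hj'
          exact (this.2 (.inr hj')).resolve_left (h₂.1 j hj').ne
      · exfalso
        have hma : m < a := by
          rcases hm₂ with rfl | hm₂
          · exact hab
          · exact (h₂.1 m hm₂).trans hab
        rcases (h a hma).1 (.inl rfl) with rfl | h'
        · exact hab.false
        · exact (hab.trans (h₂.1 a h')).false

variable {V : Type*} [Fintype V] {G : SimpleGraph V}

theorem mem_label {σ : V → ℕ} {k : ℕ} {v : V} {j : ℕ} :
    j ∈ label G σ k v ↔ ∃ w, G.Adj v w ∧ k < σ w ∧ σ w = j := by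
  simp [label, and_assoc]

theorem pairwise_label (σ : V → ℕ) (k : ℕ) (v : V) : (label G σ k v).Pairwise (· > ·) := by
  exact (Finset.sortedGT_sort _).pairwise

theorem IsLBFSOrdering.le_card {s : V} {σ : V → ℕ} (h : IsLBFSOrdering G s σ) (v : V) :
    σ v ≤ Fintype.card V :=
  (h.1.mapsTo (Set.mem_univ v)).2

theorem IsLBFSOrdering.one_le {s : V} {σ : V → ℕ} (h : IsLBFSOrdering G s σ) (v : V) :
    1 ≤ σ v :=
  (h.1.mapsTo (Set.mem_univ v)).1

theorem IsLBFSOrdering.injective {s : V} {σ : V → ℕ} (h : IsLBFSOrdering G s σ) :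
    Function.Injective σ :=
  Set.injOn_univ.1 h.1.injOn

theorem IsLBFSOrdering.lt_iff {s : V} {σ : V → ℕ} (h : IsLBFSOrdering G s σ) (u v : V) :
    σ v < σ u ↔ Fintype.card V - σ u < Fintype.card V - σ v := by
  have := h.le_card u
  have := h.le_card v
  omega

/-- Numbers are handed out downwards, so `card V - σ v` is the position of `v`. If `u` wins against
`v` at the first difference `w`, its label is larger at the number `σ w`, against the choice of `v`.
-/
theorem IsLBFSOrdering.isLexOrder {s : V} {σ : V → ℕ} (h : IsLBFSOrdering G s σ) :
    IsLexOrder G fun v => Fintype.card V - σ v := by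
  refine isLexOrder_of_no_witness fun u v w hvu hwv hwu hnwv hall => ?_
  rw [← h.lt_iff] at hvu hwv
  refine h.2.2 v u hvu.le (lex_of_sortedGT (pairwise_label _ _ _) (pairwise_label _ _ _)
    (m := σ w) ?_ ?_ ?_)
  · rw [mem_label]
    rintro ⟨z, hz, -, he⟩
    exact hnwv (h.injective he ▸ hz.symm)
  · rw [mem_label]
    exact ⟨w, hwu.symm, hwv, rfl⟩
  · intro j hj
    rw [mem_label, mem_label]
    refine exists_congr fun z => ?_
    constructor
    · rintro ⟨h1, h2, rfl⟩
      exact ⟨((hall z ((h.lt_iff _ _).1 hj)).2 h1.symm).symm, h2, rfl⟩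
    · rintro ⟨h1, h2, rfl⟩
      exact ⟨((hall z ((h.lt_iff _ _).1 hj)).1 h1.symm).symm, h2, rfl⟩

theorem IsLBFSOrdering.position_injective {s : V} {σ : V → ℕ} (h : IsLBFSOrdering G s σ) :
    Function.Injective fun v => Fintype.card V - σ v := fun u v huv => h.injective <| by
  have := h.le_card u
  have := h.le_card v
  dsimp only at huv
  omega

theorem IsLBFSOrdering.isAdmissibleOrder {s x : V} {τ σ : V → ℕ} (hG : IsATFree G)
    (hτ : IsLBFSOrdering G s τ) (hx : τ x = 1) (hσ : IsLBFSOrdering G x σ) :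
    IsAdmissibleOrder G x fun v => Fintype.card V - σ v where
  lex := hσ.isLexOrder
  injective := hσ.position_injective
  start_le y := by simp [hσ.2.1]
  admissible := by
    refine isAdmissible_last hG hτ.isLexOrder hτ.position_injective fun y => ?_
    have := hτ.one_le y
    omega

end Labels

/-! ### Searches driven by ranks instead of labels -/

section Ranks

variable {V : Type*} {G : SimpleGraph V}

/-- The state of a lexicographic search from `s` that has visited `t` vertices. Here `p v` is
the position of a visited vertex `v` and `n` for the others, and the ranks `r v` compare like
the labels. -/
structure RankInvariant (G : SimpleGraph V) (s : V) (n t : ℕ) (p r : V → ℕ) : Prop where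
  lt_or_eq : ∀ v, p v < t ∨ p v = n
  inj : ∀ u v, p u < t → p u = p v → u = v
  surj : ∀ i < t, ∃ v, p v = i
  start : 0 < t → p s = 0
  init : t = 0 → 0 < r s ∧ ∀ v, v ≠ s → r v = 0
  lex : ∀ u v w, p v < p u → p w < p v → G.Adj w u → ¬ G.Adj w v →
    ¬ ∀ w', p w' < p w → (G.Adj w' u ↔ G.Adj w' v)
  rank_eq : ∀ u v, u ≠ s → v ≠ s → (∀ w, p w < t → (G.Adj w u ↔ G.Adj w v)) → r u = r v
  rank_lt : ∀ u v w, u ≠ s → v ≠ s → p w < t → G.Adj w v → ¬ G.Adj w u →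
    (∀ w', p w' < p w → (G.Adj w' v ↔ G.Adj w' u)) → r u < r v

/-- Rank one forces `s` to be visited first. As this is not the order of labels, the clauses
`rank_eq` and `rank_lt` leave `s` out. -/
theorem RankInvariant.zero {s : V} {n : ℕ} {p r : V → ℕ} (hp : ∀ v, p v = n) (hs : r s = 1)
    (hr : ∀ v, v ≠ s → r v = 0) : RankInvariant G s n 0 p r where
  lt_or_eq v := .inr (hp v)
  inj _ _ h := absurd h (Nat.not_lt_zero _)
  surj _ h := absurd h (Nat.not_lt_zero _)
  start h := absurd h (Nat.not_lt_zero _)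
  init _ := ⟨by omega, hr⟩
  lex u v w h := by rw [hp, hp] at h; omega
  rank_eq u v hu hv _ := by rw [hr u hu, hr v hv]
  rank_lt _ _ _ _ _ h := absurd h (Nat.not_lt_zero _)

/-- The newest number is the smallest, so it is the least significant entry of a label. Hence the
new ranks need only order the pairs (old rank, adjacency to `b`) lexicographically. -/
theorem RankInvariant.step [DecidableEq V] {s b : V} {n t : ℕ} {p r r' : V → ℕ}
    (h : RankInvariant G s n t p r) (ht : t < n) (hb : p b = n)
    (hmax : ∀ v, p v = n → r v ≤ r b)
    (heq : ∀ u v, r u = r v → (G.Adj b u ↔ G.Adj b v) → r' u = r' v)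
    (hlt : ∀ u v, r u < r v ∨ r u = r v ∧ ¬ G.Adj b u ∧ G.Adj b v → r' u < r' v) :
    RankInvariant G s n (t + 1) (Function.update p b t) r' := by
  have pb : Function.update p b t b = t := Function.update_self ..
  have pne : ∀ {v}, v ≠ b → Function.update p b t v = p v := fun hv =>
    Function.update_of_ne hv ..
  have vis : ∀ {v}, p v < t → v ≠ b := by rintro v hv rfl; omega
  have lt_iff : ∀ {v k}, k ≤ t → (Function.update p b t v < k ↔ p v < k) := by
    intro v k hk
    by_cases hv : v = b
    · subst hv; rw [pb]; omega
    · rw [pne hv]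
  have lt_succ : ∀ {v}, Function.update p b t v < t + 1 → v = b ∨ p v < t := by
    intro v hv
    by_cases hvb : v = b
    · exact .inl hvb
    · rw [pne hvb] at hv
      rcases h.lt_or_eq v with h' | h'
      · exact .inr h'
      · omega
  have le_n : ∀ v, Function.update p b t v ≤ n := by
    intro v
    by_cases hvb : v = b
    · subst hvb; rw [pb]; omega
    · rw [pne hvb]
      rcases h.lt_or_eq v with h' | h' <;> omega
  have sb : 0 < t → s ≠ b := fun h0 => vis ((h.start h0).symm ▸ h0)
  refine ⟨fun v => ?_, fun u v hu huv => ?_, fun i hi => ?_, fun _ => ?_, fun h0 => ?_,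
    fun u v w hvu hwv hwu hnwv hall => ?_, fun u v hu hv hall => ?_,
    fun u v w hu hv hw hwv hnwu hall => ?_⟩
  · by_cases hvb : v = b
    · subst hvb; left; rw [pb]; omega
    · rw [pne hvb]
      rcases h.lt_or_eq v with h' | h' <;> omega
  · rcases lt_succ hu with rfl | hu'
    · by_contra hne
      rw [pb, pne (Ne.symm hne)] at huv
      rcases h.lt_or_eq v with h' | h' <;> omega
    · rw [pne (vis hu')] at huv
      by_cases hvb : v = b
      · subst hvb; rw [pb] at huv; omega
      · rw [pne hvb] at huv
        exact h.inj u v hu' huv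
  · rcases (Nat.lt_succ_iff.1 hi).eq_or_lt with rfl | hi'
    · exact ⟨b, pb⟩
    · obtain ⟨v, rfl⟩ := h.surj i hi'
      exact ⟨v, pne (vis hi')⟩
  · rcases t.eq_zero_or_pos with rfl | h0
    · have : b = s := by
        by_contra hbs
        have h1 := h.init rfl
        have h2 := hmax s ((h.lt_or_eq s).resolve_left (Nat.not_lt_zero _))
        rw [h1.2 b hbs] at h2
        omega
      rw [← this, pb]
    · rw [pne (sb h0), h.start h0]
  · omega
  · by_cases hvb : v = b
    · subst hvb
      rw [pb] at hvu hwv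
      have hwt := (lt_iff le_rfl).1 hwv
      have huv : u ≠ v := by rintro rfl; rw [pb] at hvu; omega
      rw [pne huv] at hvu
      have hun : p u = n := (h.lt_or_eq u).resolve_left (by omega)
      have h0 : 0 < t := by omega
      -- An unvisited `u` that wins against the chosen vertex at the first difference would have
      -- larger rank.
      refine (hmax u hun).not_gt (h.rank_lt v u w (sb h0).symm ?_ hwt hwu hnwv fun w' hw' => ?_)
      · rintro rfl; rw [h.start h0] at hvu; omega
      · exact hall w' (by rw [pne (vis hwt)]; exact (lt_iff hwt.le).2 hw')
    · rw [pne hvb] at hvu hwv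
      have hvt : p v < t := (h.lt_or_eq v).resolve_right (by have := le_n u; omega)
      have hwv' := (lt_iff hvt.le).1 hwv
      have hvu' : p v < p u := by
        by_cases hub : u = b
        · subst hub; omega
        · rwa [pne hub] at hvu
      refine h.lex u v w hvu' hwv' hwu hnwv fun w' hw' => hall w' ?_
      rw [pne (vis (hwv'.trans hvt))]
      exact (lt_iff (hwv'.trans hvt).le).2 hw'
  · refine heq u v (h.rank_eq u v hu hv fun w hw => hall w ?_) (hall b (by rw [pb]; omega))
    rw [pne (vis hw)]; omega
  · apply hlt
    rcases lt_succ hw with rfl | hw'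
    · right
      refine ⟨h.rank_eq u v hu hv fun w' hw' => (hall w' ?_).symm, hnwu, hwv⟩
      rw [pb]
      exact (lt_iff le_rfl).2 hw'
    · left
      refine h.rank_lt u v w hu hv hw' hwv hnwu fun w' hw'' => hall w' ?_
      rw [pne (vis hw')]
      exact (lt_iff hw'.le).2 hw''

theorem RankInvariant.isLexOrder {s : V} {n t : ℕ} {p r : V → ℕ}
    (h : RankInvariant G s n t p r) : IsLexOrder G p :=
  isLexOrder_of_no_witness h.lex

variable [Fintype V]

theorem RankInvariant.exists_unvisited {s : V} {n t : ℕ} {p r : V → ℕ}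
    (h : RankInvariant G s n t p r) (hn : Fintype.card V = n) (ht : t < n) :
    ∃ v, p v = n := by
  subst hn
  by_contra hn
  push Not at hn
  have hv : ∀ v, p v < t := fun v => (h.lt_or_eq v).resolve_right (hn v)
  have := Fintype.card_le_of_injective (fun v => (⟨p v, hv v⟩ : Fin t))
    (fun u v huv => h.inj u v (hv u) (Fin.mk.inj_iff.1 huv))
  rw [Fintype.card_fin] at this
  omega

theorem RankInvariant.lt_card {s : V} {n : ℕ} {p r : V → ℕ}
    (h : RankInvariant G s n n p r) (hn : Fintype.card V = n) (v : V) : p v < n := by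
  subst hn
  choose f hf using fun i : Fin (Fintype.card V) => h.surj i i.2
  have hinj : Function.Injective f := fun i j hij => Fin.ext (by rw [← hf i, ← hf j, hij])
  obtain ⟨i, rfl⟩ := ((Fintype.bijective_iff_injective_and_card f).2 ⟨hinj, by simp⟩).2 v
  rw [hf]
  exact i.2

theorem RankInvariant.injective {s : V} {n : ℕ} {p r : V → ℕ}
    (h : RankInvariant G s n n p r) (hn : Fintype.card V = n) : Function.Injective p :=
  fun u v huv => h.inj u v (h.lt_card hn u) huv

/-- Two lexicographic searches, the second from the last vertex of the first, yield an
admissible order. -/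
theorem RankInvariant.isAdmissibleOrder {s x : V} {n : ℕ} {p r q r' : V → ℕ}
    (hG : IsATFree G) (h : RankInvariant G s n n p r) (hn : Fintype.card V = n)
    (hx : ∀ y, p y ≤ p x) (h' : RankInvariant G x n n q r') :
    IsAdmissibleOrder G x q where
  lex := h'.isLexOrder
  injective := h'.injective hn
  start_le y := by rw [h'.start (hn ▸ Fintype.card_pos_iff.2 ⟨x⟩)]; exact Nat.zero_le _
  admissible := isAdmissible_last hG h.isLexOrder (h.injective hn) hx

/-- The number of values below `k` that the keys take. -/
def countKeys (key : V → ℕ) (k : ℕ) : ℕ :=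
  ((Finset.range k).filter fun j => ∃ u, key u = j).card

theorem countKeys_lt_countKeys {key : V → ℕ} {u v : V} (h : key u < key v) :
    countKeys key (key u) < countKeys key (key v) := by
  refine Finset.card_lt_card (Finset.ssubset_iff_of_subset (fun j hj => ?_) |>.2
    ⟨key u, by simp [h], by simp⟩)
  simp only [Finset.mem_filter, Finset.mem_range] at hj ⊢
  exact ⟨hj.1.trans h, hj.2⟩

theorem countKeys_le_card (key : V → ℕ) (k : ℕ) : countKeys key k ≤ Fintype.card V := by
  classical
  refine (Finset.card_le_card (t := Finset.univ.image key) fun j hj => ?_).trans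
    Finset.card_image_le
  simp only [Finset.mem_filter] at hj
  simpa using hj.2

theorem countKeys_lt_card (key : V → ℕ) (v : V) :
    countKeys key (key v) < Fintype.card V := by
  refine lt_of_lt_of_le ?_ (countKeys_le_card key (key v + 1))
  refine Finset.card_lt_card (Finset.ssubset_iff_of_subset (fun j hj => ?_) |>.2
    ⟨key v, by simp, by simp⟩)
  simp only [Finset.mem_filter, Finset.mem_range] at hj ⊢
  exact ⟨by omega, hj.2⟩

/-- The keys order the pairs (rank, adjacency to `b`) lexicographically, and counting the distinct
smaller keys preserves both equality and strict order. -/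
theorem RankInvariant.step_countKeys [DecidableEq V] {s b : V} {n t : ℕ} {p r : V → ℕ}
    {key : V → ℕ} (h : RankInvariant G s n t p r) (ht : t < n) (hb : p b = n)
    (hmax : ∀ v, p v = n → r v ≤ r b)
    (hadj : ∀ v, G.Adj b v → key v = 2 * r v + 1) (hnadj : ∀ v, ¬ G.Adj b v → key v = 2 * r v) :
    RankInvariant G s n (t + 1) (Function.update p b t) fun v => countKeys key (key v) := by
  refine h.step ht hb hmax (fun u v he hiff => ?_) (fun u v huv => countKeys_lt_countKeys ?_)
  · congr 1
    by_cases hv : G.Adj b v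
    · rw [hadj u (hiff.2 hv), hadj v hv, he]
    · rw [hnadj u (fun hu => hv (hiff.1 hu)), hnadj v hv, he]
  · by_cases hu : G.Adj b u <;> by_cases hv : G.Adj b v <;>
      simp only [hu, hv, hadj, hnadj, not_true, not_false_iff, and_true, and_false,
        or_false] at huv ⊢ <;> omega

/-- Supplies the two searches for the bound on path-length, over an arbitrary finite vertex type. -/
theorem exists_rankInvariant (G : SimpleGraph V) (s : V) {t : ℕ} (ht : t ≤ Fintype.card V) :
    ∃ p r, RankInvariant G s (Fintype.card V) t p r := by
  classical
  induction t with
  | zero => exact ⟨fun _ => Fintype.card V, Pi.single s 1, .zero (fun _ => rfl) (by simp)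
      (fun v hv => by simp [hv])⟩
  | succ t ih =>
    obtain ⟨p, r, h⟩ := ih (by omega)
    obtain ⟨v, hv⟩ := h.exists_unvisited rfl ht
    obtain ⟨b, hb, hmax⟩ := (Finset.univ.filter fun v => p v = Fintype.card V).exists_max_image r
      ⟨v, by simpa using hv⟩
    simp only [Finset.mem_filter, Finset.mem_univ, true_and] at hb hmax
    exact ⟨_, _, h.step_countKeys (key := fun v => 2 * r v + if G.Adj b v then 1 else 0) ht hb
      hmax (fun v hv => by simp [hv]) (fun v hv => by simp [hv])⟩

theorem pathLength_le_two [Nonempty V] {G : SimpleGraph V} (hG : G.Connected)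
    (hAT : IsATFree G) : pathLength G ≤ 2 := by
  obtain ⟨p, r, h⟩ := exists_rankInvariant G (Classical.arbitrary V) le_rfl
  obtain ⟨x, -, hx⟩ := Finset.univ.exists_max_image p Finset.univ_nonempty
  obtain ⟨q, r', h'⟩ := exists_rankInvariant G x le_rfl
  exact (iInf_le _ (spanDecomposition G q _ (h'.lt_card rfl))).trans
    ((h.isAdmissibleOrder hAT rfl (fun y => hx y (Finset.mem_univ y)) h').length_spanDecomposition_le
      hG _ _)

end Ranks

/-! ### Program logic with running times -/

section Machine

/-- Execute the programs in turn. -/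
def block : List Prog → Prog
  | [] => .skip
  | p :: ps => .seq p (block ps)

/-- The final state of a program without loops. -/
def Prog.run : Prog → State → State
  | .skip, s => s
  | .const d c, s => s.setReg d c
  | .arith o d a b, s => s.setReg d (o.eval (s.reg a) (s.reg b))
  | .load d a, s => s.setReg d (s.mem (s.reg a))
  | .store a b, s => s.setMem (s.reg a) (s.reg b)
  | .seq p q, s => q.run (p.run s)
  | .branch a b p q, s => if s.reg a < s.reg b then p.run s else q.run s
  | .loop _ _ _, s => s

/-- The program has no loops and all the numbers that it writes fit into words. -/
def Prog.Safe (W : ℕ) : Prog → State → Prop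
  | .skip, _ => True
  | .const _ c, _ => c < W
  | .arith o _ a b, s => o.eval (s.reg a) (s.reg b) < W
  | .load _ a, s => s.mem (s.reg a) < W
  | .store _ b, s => s.reg b < W
  | .seq p q, s => p.Safe W s ∧ q.Safe W (p.run s)
  | .branch a b p q, s => if s.reg a < s.reg b then p.Safe W s else q.Safe W s
  | .loop _ _ _, _ => False

/-- A bound on the number of steps of a program without loops. -/
def Prog.cost : Prog → ℕ
  | .seq p q => p.cost + q.cost
  | .branch _ _ p q => p.cost + q.cost + 1
  | _ => 1

/-- Reduces loop-free code to the recursive functions `run` and `Safe`, which `simp` can evaluate.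
Charging both arms of a branch makes the bound independent of the state. -/
theorem Prog.Safe.exec {W : ℕ} {p : Prog} {s : State} (h : p.Safe W s) :
    ∃ c ≤ p.cost, Exec W p s (p.run s) c := by
  induction p generalizing s with
  | skip => exact ⟨1, le_rfl, .skip s⟩
  | const d c => exact ⟨1, le_rfl, .const s d c h⟩
  | arith o d a b => exact ⟨1, le_rfl, .arith s o d a b h⟩
  | load d a => exact ⟨1, le_rfl, .load s d a h⟩
  | store a b => exact ⟨1, le_rfl, .store s a b h⟩
  | seq p q ihp ihq =>
    obtain ⟨c, hc, hp⟩ := ihp h.1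
    obtain ⟨c', hc', hq⟩ := ihq h.2
    exact ⟨c + c', add_le_add hc hc', .seq hp hq⟩
  | branch a b p q ihp ihq =>
    simp only [Prog.Safe] at h
    simp only [Prog.run, Prog.cost]
    split_ifs at h ⊢ with hab
    · obtain ⟨c, hc, hp⟩ := ihp h
      exact ⟨c + 1, by omega, .branch_true hab hp⟩
    · obtain ⟨c, hc, hq⟩ := ihq h
      exact ⟨c + 1, by omega, .branch_false hab hq⟩
  | loop a b p => exact h.elim

/-- Started in the state `s`, the program halts after at most `c` steps in a state with the
property `Q`. -/
def Terminates (W : ℕ) (p : Prog) (s : State) (c : ℕ) (Q : State → Prop) : Prop :=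
  ∃ t c', Exec W p s t c' ∧ c' ≤ c ∧ Q t

theorem Terminates.of_safe {W : ℕ} {p : Prog} {s : State} {Q : State → Prop} (h : p.Safe W s)
    (hQ : Q (p.run s)) : Terminates W p s p.cost Q := by
  obtain ⟨c, hc, he⟩ := h.exec
  exact ⟨_, c, he, hc, hQ⟩

theorem Terminates.mono {W : ℕ} {p : Prog} {s : State} {c c' : ℕ} {Q Q' : State → Prop}
    (h : Terminates W p s c Q) (hc : c ≤ c') (hQ : ∀ t, Q t → Q' t) :
    Terminates W p s c' Q' := by
  obtain ⟨t, d, he, hd, ht⟩ := h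
  exact ⟨t, d, he, hd.trans hc, hQ t ht⟩

theorem Terminates.of_le {W : ℕ} {p : Prog} {s : State} {c c' : ℕ} {Q : State → Prop}
    (h : Terminates W p s c Q) (hc : c ≤ c') : Terminates W p s c' Q :=
  h.mono hc fun _ h => h

theorem Terminates.seq {W : ℕ} {p q : Prog} {s : State} {c c' : ℕ} {R Q : State → Prop}
    (hp : Terminates W p s c R) (hq : ∀ t, R t → Terminates W q t c' Q) :
    Terminates W (.seq p q) s (c + c') Q := by
  obtain ⟨t, d, he, hd, ht⟩ := hp
  obtain ⟨u, d', he', hd', hu⟩ := hq t ht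
  exact ⟨u, d + d', .seq he he', add_le_add hd hd', hu⟩

theorem Terminates.nil {W : ℕ} {s : State} {Q : State → Prop} (h : Q s) :
    Terminates W (block []) s 1 Q := ⟨s, 1, .skip s, le_rfl, h⟩

theorem Terminates.cons {W : ℕ} {p : Prog} {l : List Prog} {s : State} {c c' : ℕ}
    {R Q : State → Prop} (hp : Terminates W p s c R)
    (hq : ∀ t, R t → Terminates W (block l) t c' Q) :
    Terminates W (block (p :: l)) s (c + c') Q := hp.seq hq

/-- Each round costs the body and one test; the final `1` is the failing test. -/
theorem Terminates.loop {W i b m c : ℕ} {body : Prog} {s : State} (I : ℕ → State → Prop)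
    (hreg : ∀ k t, I k t → t.reg i = k ∧ t.reg b = m)
    (hstep : ∀ k < m, ∀ t, I k t → Terminates W body t c (I (k + 1))) (h0 : I 0 s) :
    Terminates W (.loop i b body) s (m * (c + 1) + 1) (I m) := by
  suffices H : ∀ d k s, k + d = m → I k s →
      Terminates W (.loop i b body) s (d * (c + 1) + 1) (I m) from H m 0 s (by omega) h0
  intro d
  induction d with
  | zero =>
    rintro k s rfl hI
    obtain ⟨h1, h2⟩ := hreg _ _ hI
    exact ⟨s, 1, .loop_done (by omega), by omega, hI⟩
  | succ d ih =>
    intro k s hk hI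
    obtain ⟨h1, h2⟩ := hreg _ _ hI
    obtain ⟨t, e, he, hce, ht⟩ := hstep k (by omega) s hI
    obtain ⟨u, e', he', hce', hu⟩ := ih (k + 1) t (by omega) ht
    refine ⟨u, e + e' + 1, .loop_step (by omega) he he', ?_, hu⟩
    rw [Nat.succ_mul]
    omega

@[simp] theorem State.setReg_reg (s : State) (d x r : ℕ) :
    (s.setReg d x).reg r = if r = d then x else s.reg r := by
  simp [State.setReg, Function.update_apply]

@[simp] theorem State.setReg_mem (s : State) (d x : ℕ) : (s.setReg d x).mem = s.mem := rfl

@[simp] theorem State.setMem_reg (s : State) (a x : ℕ) : (s.setMem a x).reg = s.reg := rfl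

@[simp] theorem State.setMem_mem (s : State) (a x : ℕ) :
    (s.setMem a x).mem = Function.update s.mem a x := rfl

/-- `for R[i] := 0, …, R[b] - 1 do body`, where register `7` holds `1`. -/
def forLoop (i b : ℕ) (body : Prog) : Prog :=
  .seq (.const i 0) (.loop i b (.seq body (.arith .add i i 7)))

/-- By `hI` the invariant ignores the counter and so survives its increment. The increment and the
test add two steps per round; initialization and the failing test add two more. The counter reaches
`m`, whence `m < W`. -/
theorem Terminates.forLoop {W i b m c : ℕ} {body : Prog} {s : State} (I : ℕ → State → Prop)
    (hm : m < W)
    (hI : ∀ k t x, I k t → I k (t.setReg i x))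
    (hreg : ∀ k t, I k t → t.reg b = m ∧ t.reg 7 = 1)
    (hstep : ∀ k < m, ∀ t, I k t → t.reg i = k →
      Terminates W body t c fun t' => I (k + 1) t' ∧ t'.reg i = k) (h0 : I 0 s) :
    Terminates W (forLoop i b body) s (m * (c + 2) + 2) (I m) := by
  have h1 : Terminates W (.const i 0) s 1 fun t => I 0 t ∧ t.reg i = 0 :=
    .of_safe (by simp only [Prog.Safe]; omega) ⟨hI _ _ _ h0, by simp [Prog.run]⟩
  refine ((h1.seq (c' := m * (c + 1 + 1) + 1) fun t ht => Terminates.mono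
    (Terminates.loop (m := m) (c := c + 1) (fun k t => I k t ∧ t.reg i = k)
      (fun k t h => ⟨h.2, (hreg k t h.1).1⟩) (fun k hk t h => ?_) ht) le_rfl
      fun t h => h.1)).mono (by rw [show c + 1 + 1 = c + 2 from rfl]; omega) fun t h => h
  refine (hstep k hk t h.1 h.2).seq fun t' ⟨h', hk'⟩ => ?_
  have := (hreg _ _ h').2
  refine .of_safe (p := .arith .add i i 7) ?_ ⟨hI _ _ _ h', ?_⟩
  · simp only [Prog.Safe, ArithOp.eval]
    omega
  · simp [Prog.run, ArithOp.eval, hk', this]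

/-- The states agree on the registers below `12`. -/
def Same (s t : State) : Prop := ∀ r < 12, t.reg r = s.reg r

theorem Same.refl (s : State) : Same s s := fun _ _ => rfl

theorem Same.trans {s t u : State} (h : Same s t) (h' : Same t u) : Same s u :=
  fun r hr => (h' r hr).trans (h r hr)

theorem same_setReg {s t : State} {d x : ℕ} (hd : 12 ≤ d) : Same s (t.setReg d x) ↔ Same s t := by
  refine forall₂_congr fun r hr => ?_
  rw [State.setReg_reg, if_neg (by omega)]

@[simp] theorem same_setMem {s t : State} {a x : ℕ} : Same s (t.setMem a x) ↔ Same s t := Iff.rfl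

/-- A loop with counter `12` whose body has no loops and changes no register below `12`. -/
theorem Terminates.innerLoop {W b m : ℕ} {body : Prog} {s : State} (I : ℕ → State → Prop)
    (hm : m < W) (hb : b < 12) (hsb : s.reg b = m) (h7 : s.reg 7 = 1)
    (hI : ∀ k t x, I k t → I k (t.setReg 12 x))
    (hstep : ∀ k < m, ∀ t, Same s t → I k t → t.reg 12 = k →
      body.Safe W t ∧ I (k + 1) (body.run t) ∧ Same t (body.run t) ∧ (body.run t).reg 12 = k)
    (h0 : I 0 s) :
    Terminates W (ATFree.forLoop 12 b body) s (m * (body.cost + 2) + 2)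
      fun t => Same s t ∧ I m t := by
  refine Terminates.forLoop (fun k t => Same s t ∧ I k t) hm
    (fun k t x h => ⟨(same_setReg le_rfl).2 h.1, hI _ _ _ h.2⟩)
    (fun k t h => ⟨(h.1 b hb).trans hsb, (h.1 7 (by omega)).trans h7⟩)
    (fun k hk t h hk' => ?_) ⟨Same.refl s, h0⟩
  obtain ⟨h1, h2, h3, h4⟩ := hstep k hk t h.1 h.2 hk'
  exact .of_safe h1 ⟨⟨h.1.trans h3, h2⟩, h4⟩

end Machine

/-! ### The lexicographic search on the machine -/

section Search

/-- The registers that hold parameters, where `N = n * n`. -/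
structure Layout (n N : ℕ) (s : State) : Prop where
  r0 : s.reg 0 = n
  r2 : s.reg 2 = 4 * N
  r3 : s.reg 3 = N
  r4 : s.reg 4 = 2 * N
  r5 : s.reg 5 = 3 * N
  r6 : s.reg 6 = 0
  r7 : s.reg 7 = 1
  r8 : s.reg 8 = 2 * n

theorem Layout.of_same {n N : ℕ} {s t : State} (h : Layout n N s) (hst : Same s t) :
    Layout n N t where
  r0 := (hst 0 (by omega)).trans h.r0
  r2 := (hst 2 (by omega)).trans h.r2
  r3 := (hst 3 (by omega)).trans h.r3
  r4 := (hst 4 (by omega)).trans h.r4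
  r5 := (hst 5 (by omega)).trans h.r5
  r6 := (hst 6 (by omega)).trans h.r6
  r7 := (hst 7 (by omega)).trans h.r7
  r8 := (hst 8 (by omega)).trans h.r8

/-- The contents of the memory: the adjacency matrix `A` and three tables. -/
structure MemIs (n N : ℕ) (A r p k m : ℕ → ℕ) : Prop where
  adj : ∀ a < N, m a = A a
  rank : ∀ v < n, m (N + v) = r v
  pos : ∀ v < n, m (2 * N + v) = p v
  mark : ∀ j < 2 * n, m (3 * N + j) = k j

/-- The sizes of the input and of the words. -/
structure Sizes (n N W : ℕ) : Prop where
  one_lt : 1 < n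
  sq : N = n * n
  word : 16 * N ≤ W

variable {n N W : ℕ} {A r p k m : ℕ → ℕ} {s : State}

/-- With `1 < n`, even the table of marks with `2 * n` entries fits into a block of `N` cells, so
the tables do not overlap. -/
theorem Sizes.le (h : Sizes n N W) : 2 * n ≤ N := by
  rw [h.sq]
  exact Nat.mul_le_mul_right n h.one_lt

theorem Sizes.index_lt (h : Sizes n N W) {i v : ℕ} (hi : i < n) (hv : v < n) : i * n + v < N := by
  have : (i + 1) * n ≤ n * n := Nat.mul_le_mul_right n hi
  rw [h.sq]
  rw [Nat.succ_mul] at this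
  omega

theorem MemIs.congr {r' p' k' : ℕ → ℕ} (h : MemIs n N A r p k m) (hr : ∀ v < n, r v = r' v)
    (hp : ∀ v < n, p v = p' v) (hk : ∀ j < 2 * n, k j = k' j) : MemIs n N A r' p' k' m where
  adj := h.adj
  rank v hv := (h.rank v hv).trans (hr v hv)
  pos v hv := (h.pos v hv).trans (hp v hv)
  mark j hj := (h.mark j hj).trans (hk j hj)

theorem MemIs.set_rank (h : MemIs n N A r p k m) (hs : Sizes n N W) {v : ℕ} (hv : v < n) (x : ℕ) :
    MemIs n N A (Function.update r v x) p k (Function.update m (N + v) x) := by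
  have := hs.le
  refine ⟨fun a ha => ?_, fun u hu => ?_, fun u hu => ?_, fun j hj => ?_⟩
  · rw [Function.update_of_ne (by omega), h.adj a ha]
  · by_cases huv : u = v
    · subst huv; simp
    · rw [Function.update_of_ne (by omega), Function.update_of_ne huv, h.rank u hu]
  · rw [Function.update_of_ne (by omega), h.pos u hu]
  · rw [Function.update_of_ne (by omega), h.mark j hj]

theorem MemIs.set_pos (h : MemIs n N A r p k m) (hs : Sizes n N W) {v : ℕ} (hv : v < n) (x : ℕ) :
    MemIs n N A r (Function.update p v x) k (Function.update m (2 * N + v) x) := by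
  have := hs.le
  refine ⟨fun a ha => ?_, fun u hu => ?_, fun u hu => ?_, fun j hj => ?_⟩
  · rw [Function.update_of_ne (by omega), h.adj a ha]
  · rw [Function.update_of_ne (by omega), h.rank u hu]
  · by_cases huv : u = v
    · subst huv; simp
    · rw [Function.update_of_ne (by omega), Function.update_of_ne huv, h.pos u hu]
  · rw [Function.update_of_ne (by omega), h.mark j hj]

theorem MemIs.set_mark (h : MemIs n N A r p k m) (hs : Sizes n N W) {i : ℕ} (hi : i < 2 * n)
    (x : ℕ) : MemIs n N A r p (Function.update k i x) (Function.update m (3 * N + i) x) := by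
  have := hs.le
  refine ⟨fun a ha => ?_, fun u hu => ?_, fun u hu => ?_, fun j hj => ?_⟩
  · rw [Function.update_of_ne (by omega), h.adj a ha]
  · rw [Function.update_of_ne (by omega), h.rank u hu]
  · rw [Function.update_of_ne (by omega), h.pos u hu]
  · by_cases hij : j = i
    · subst hij; simp
    · rw [Function.update_of_ne (by omega), Function.update_of_ne hij, h.mark j hj]

theorem MemIs.set_out (h : MemIs n N A r p k m) (hs : Sizes n N W) {a : ℕ} (ha : 4 * N ≤ a)
    (x : ℕ) : MemIs n N A r p k (Function.update m a x) := by
  have := hs.le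
  refine ⟨fun b hb => ?_, fun u hu => ?_, fun u hu => ?_, fun j hj => ?_⟩
  · rw [Function.update_of_ne (by omega), h.adj b hb]
  · rw [Function.update_of_ne (by omega), h.rank u hu]
  · rw [Function.update_of_ne (by omega), h.pos u hu]
  · rw [Function.update_of_ne (by omega), h.mark j hj]

/-- The table `g`, with the first `i` entries replaced by those of `f`. -/
def prefixed (i : ℕ) (f g : ℕ → ℕ) : ℕ → ℕ := fun v => if v < i then f v else g v

@[simp] theorem prefixed_zero (f g : ℕ → ℕ) : prefixed 0 f g = g := by
  funext v; simp [prefixed]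

theorem prefixed_of_lt {i v : ℕ} (f g : ℕ → ℕ) (h : v < i) : prefixed i f g v = f v := if_pos h

@[simp] theorem prefixed_self (i : ℕ) (f g : ℕ → ℕ) : prefixed i f g i = g i := by simp [prefixed]

/-- The step of every loop that fills a table from left to right. -/
theorem update_prefixed (i : ℕ) (f g : ℕ → ℕ) :
    Function.update (prefixed i f g) i (f i) = prefixed (i + 1) f g := by
  funext v
  by_cases h : v = i
  · subst h; simp [prefixed]
  · rw [Function.update_of_ne h]
    have : v < i + 1 ↔ v < i := by omega
    simp [prefixed, this]

/-- Set all ranks to zero. -/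
def initRanks : Prog := forLoop 12 0 (block [.arith .add 13 3 12, .store 13 6])

theorem terminates_initRanks (hs : Sizes n N W) (hl : Layout n N s)
    (hm : MemIs n N A r p k s.mem) :
    Terminates W initRanks s (40 * n) fun t => Same s t ∧ MemIs n N A 0 p k t.mem := by
  have h1 := hs.le
  have h2 := hs.one_lt
  have h3 := hs.word
  refine (Terminates.innerLoop (m := n) (fun i t => MemIs n N A (prefixed i 0 r) p k t.mem)
    (by omega) (by omega) hl.r0 hl.r7 (fun _ _ _ h => h) (fun i hi t hst ht h12 => ?_)
    (by simpa using hm)).mono ?_ fun t ht => ⟨ht.1, ht.2.congr (fun v hv => prefixed_of_lt _ _ hv)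
      (fun _ _ => rfl) (fun _ _ => rfl)⟩
  · have hlt := hl.of_same hst
    simp [Prog.Safe, Prog.run, block, ArithOp.eval, h12, hlt.r3, hlt.r6, same_setReg, Same.refl]
    refine ⟨⟨by omega, by omega⟩, ?_⟩
    rw [← update_prefixed]
    exact ht.set_rank hs hi 0
  · simp only [Prog.cost, block]; omega

/-- Set all positions to `n`. -/
def initPositions : Prog := forLoop 12 0 (block [.arith .add 13 4 12, .store 13 0])

theorem terminates_initPositions (hs : Sizes n N W) (hl : Layout n N s)
    (hm : MemIs n N A r p k s.mem) :
    Terminates W initPositions s (40 * n)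
      fun t => Same s t ∧ MemIs n N A r (fun _ => n) k t.mem := by
  have h1 := hs.le
  have h2 := hs.one_lt
  have h3 := hs.word
  refine (Terminates.innerLoop (m := n)
    (fun i t => MemIs n N A r (prefixed i (fun _ => n) p) k t.mem)
    (by omega) (by omega) hl.r0 hl.r7 (fun _ _ _ h => h) (fun i hi t hst ht h12 => ?_)
    (by simpa using hm)).mono ?_ fun t ht => ⟨ht.1, ht.2.congr (fun _ _ => rfl)
      (fun v hv => prefixed_of_lt _ _ hv) (fun _ _ => rfl)⟩
  · have hlt := hl.of_same hst
    simp [Prog.Safe, Prog.run, block, ArithOp.eval, h12, hlt.r4, hlt.r0, same_setReg, Same.refl]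
    refine ⟨⟨by omega, by omega⟩, ?_⟩
    rw [← update_prefixed]
    exact ht.set_pos hs hi n
  · simp only [Prog.cost, block]; omega

/-- Find an unvisited vertex of largest rank. -/
def findBest : Prog := block [.const 13 0, forLoop 12 0 (block [.arith .add 15 4 12, .load 15 15,
  .branch 15 0 .skip (block [.arith .add 15 3 12, .load 15 15, .arith .add 15 15 7,
    .branch 13 15 (block [.arith .add 13 15 6, .arith .add 14 12 6]) .skip])])]

/-- Register `14` holds an unvisited vertex of largest rank among the first `i` vertices, if there
is one, and register `13` its rank plus one. -/
def IsBest (n : ℕ) (r p : ℕ → ℕ) (i : ℕ) (t : State) : Prop :=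
  (∀ v < i, p v = n → r v < t.reg 13) ∧
    (t.reg 13 = 0 ∨ t.reg 14 < i ∧ p (t.reg 14) = n ∧ t.reg 13 = r (t.reg 14) + 1)

theorem terminates_findBest (hs : Sizes n N W) (hl : Layout n N s)
    (hm : MemIs n N A r p k s.mem) (hr : ∀ v < n, r v < n) (hp : ∀ v < n, p v ≤ n) :
    Terminates W findBest s (40 * n)
      fun t => Same s t ∧ MemIs n N A r p k t.mem ∧ IsBest n r p n t := by
  have h1 := hs.le
  have h2 := hs.one_lt
  have h3 := hs.word
  refine Terminates.of_le (Terminates.cons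
    (.of_safe (Q := fun t => Same s t ∧ t.mem = s.mem ∧ t.reg 13 = 0) ?_ ?_)
    fun s' ⟨hss, hmem, h13⟩ => Terminates.cons (Terminates.innerLoop (m := n)
    (fun i t => MemIs n N A r p k t.mem ∧ IsBest n r p i t)
    (by omega) (by omega) (hl.of_same hss).r0 (hl.of_same hss).r7 (fun i t x h => ?_)
    (fun i hi t hst ht h12 => ?_)
    ⟨hmem ▸ hm, by simp, .inl h13⟩) fun t ht => .nil ⟨hss.trans ht.1, ht.2⟩) ?_
  · simp [Prog.Safe]; omega
  · simp [Prog.run, same_setReg, Same.refl]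
  · simpa [IsBest] using h
  · have hlt := (hl.of_same hss).of_same hst
    obtain ⟨ht, hb⟩ := ht
    have hpi := ht.pos i hi
    have hri := ht.rank i hi
    have hri' := hr i hi
    have hpi' := hp i hi
    rcases hpi'.lt_or_eq with hlt' | heq
    · simp [Prog.Safe, Prog.run, block, ArithOp.eval, h12, hlt.r4, hlt.r0, same_setReg, Same.refl,
        hpi, hlt']
      refine ⟨⟨by omega, by omega⟩, ht, fun v hv hvn => ?_, ?_⟩
      · rcases (Nat.lt_succ_iff.1 hv).eq_or_lt with rfl | hv
        · omega
        · simpa using hb.1 v hv hvn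
      · simpa using hb.2.imp_right fun h => ⟨by omega, h.2⟩
    · by_cases hc : t.reg 13 < r i + 1
      · simp [Prog.Safe, Prog.run, block, ArithOp.eval, h12, hlt.r4, hlt.r0, hlt.r3, hlt.r6, hlt.r7,
          same_setReg, Same.refl, hpi, heq, hri, hc]
        refine ⟨by omega, ht,
          fun v hv hvn => ?_, .inr ?_⟩
        · rcases (Nat.lt_succ_iff.1 hv).eq_or_lt with rfl | hv
          · simp
          · have := hb.1 v hv hvn
            simp
            omega
        · simp [heq]
      · simp [Prog.Safe, Prog.run, block, ArithOp.eval, h12, hlt.r4, hlt.r0, hlt.r3, hlt.r7,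
          same_setReg, Same.refl, hpi, heq, hri, hc]
        refine ⟨⟨by omega, by omega, by omega, by omega, by omega⟩, ht, fun v hv hvn => ?_, ?_⟩
        · rcases (Nat.lt_succ_iff.1 hv).eq_or_lt with rfl | hv
          · simp
            omega
          · simpa using hb.1 v hv hvn
        · simpa using hb.2.imp_right fun h => ⟨by omega, h.2⟩
  · simp only [Prog.cost, block]; omega

/-- Replace the rank of every vertex by its key: twice the rank, plus one for the neighbours of the
vertex in register `10`. -/
def setKeys : Prog := forLoop 12 0 (block [.arith .mul 15 10 0, .arith .add 15 15 12, .load 15 15,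
  .arith .add 16 3 12, .load 17 16, .arith .add 17 17 17, .arith .add 17 17 15, .store 16 17])

theorem terminates_setKeys (hs : Sizes n N W) (hl : Layout n N s)
    (hm : MemIs n N A r p k s.mem) (hr : ∀ v < n, r v < n) (hA : ∀ a, A a ≤ 1) {b : ℕ}
    (hb : b < n) (h10 : s.reg 10 = b) :
    Terminates W setKeys s (40 * n)
      fun t => Same s t ∧ MemIs n N A (fun v => 2 * r v + A (b * n + v)) p k t.mem := by
  have h1 := hs.le
  have h2 := hs.one_lt
  have h3 := hs.word
  refine (Terminates.innerLoop (m := n)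
    (fun i t => MemIs n N A (prefixed i (fun v => 2 * r v + A (b * n + v)) r) p k t.mem)
    (by omega) (by omega) hl.r0 hl.r7 (fun _ _ _ h => h) (fun i hi t hst ht h12 => ?_)
    (by simpa using hm)).mono ?_ fun t ht => ⟨ht.1, ht.2.congr
      (fun v hv => prefixed_of_lt _ _ hv) (fun _ _ => rfl) (fun _ _ => rfl)⟩
  · have hlt := hl.of_same hst
    have h10' : t.reg 10 = b := (hst 10 (by omega)).trans h10
    have hi' := hs.index_lt hb hi
    have hadj := ht.adj _ hi'
    have hA' := hA (b * n + i)
    have hri := ht.rank i hi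
    have hri' := hr i hi
    simp [Prog.Safe, Prog.run, block, ArithOp.eval, h12, hlt.r3, hlt.r0, same_setReg, Same.refl,
      h10', hadj, hri]
    refine ⟨⟨by omega, by omega, by omega, by omega, by omega, by omega, by omega⟩, ?_⟩
    rw [← update_prefixed, ← two_mul]
    exact ht.set_rank hs hi _
  · simp only [Prog.cost, block]; omega

/-- Mark the numbers that occur as ranks. -/
def setMarks : Prog := forLoop 12 0 (block [.arith .add 15 3 12, .load 15 15, .arith .add 15 15 5,
  .store 15 7])

open Classical in
theorem terminates_setMarks (hs : Sizes n N W) (hl : Layout n N s)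
    (hm : MemIs n N A r p 0 s.mem) (hr : ∀ v < n, r v < 2 * n) :
    Terminates W setMarks s (40 * n) fun t => Same s t ∧
      MemIs n N A r p (fun j => if ∃ v : Fin n, r v = j then 1 else 0) t.mem := by
  have h1 := hs.le
  have h2 := hs.one_lt
  have h3 := hs.word
  refine (Terminates.innerLoop (m := n)
    (fun i t => MemIs n N A r p (fun j => if ∃ v < i, r v = j then 1 else 0) t.mem)
    (by omega) (by omega) hl.r0 hl.r7 (fun _ _ _ h => h) (fun i hi t hst ht h12 => ?_)
    ?_).mono ?_ fun t ht => ⟨ht.1, ht.2.congr (fun _ _ => rfl) (fun _ _ => rfl)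
      (fun j _ => by simp [Fin.exists_iff])⟩
  · have hlt := hl.of_same hst
    have hri := ht.rank i hi
    have hri' := hr i hi
    simp [Prog.Safe, Prog.run, block, ArithOp.eval, h12, hlt.r3, hlt.r5, hlt.r7, same_setReg,
      Same.refl, hri]
    refine ⟨⟨by omega, by omega, by omega, by omega⟩, ?_⟩
    rw [add_comm (r i)]
    refine (ht.set_mark hs hri' 1).congr (fun _ _ => rfl) (fun _ _ => rfl) fun j hj => ?_
    have hiff : (∃ v ≤ i, r v = j) ↔ j = r i ∨ ∃ v < i, r v = j := by
      constructor
      · rintro ⟨v, hv, rfl⟩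
        rcases hv.eq_or_lt with rfl | hv
        · exact .inl rfl
        · exact .inr ⟨v, hv, rfl⟩
      · rintro (rfl | ⟨v, hv, rfl⟩)
        · exact ⟨i, by omega, rfl⟩
        · exact ⟨v, by omega, rfl⟩
    simp only [Function.update_apply, hiff]
    by_cases hj' : j = r i <;> simp [hj']
  · exact hm.congr (fun _ _ => rfl) (fun _ _ => rfl) (fun _ _ => by simp)
  · simp only [Prog.cost, block]; omega

/-- Replace the table of marks by the table of its partial sums. -/
def sumMarks : Prog := block [.const 13 0, forLoop 12 8 (block [.arith .add 15 5 12, .load 16 15,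
  .store 15 13, .arith .add 13 13 16])]

theorem terminates_sumMarks (hs : Sizes n N W) (hl : Layout n N s)
    (hm : MemIs n N A r p k s.mem) (hk : ∀ j, k j ≤ 1) :
    Terminates W sumMarks s (40 * n) fun t => Same s t ∧
      MemIs n N A r p (fun j => ∑ i ∈ Finset.range j, k i) t.mem := by
  have h1 := hs.le
  have h2 := hs.one_lt
  have h3 := hs.word
  -- The sums are exclusive: cell `j` receives the number of marks strictly below `j`. This is at
  -- most `j`, so it fits into a word.
  have hle : ∀ j, ∑ i ∈ Finset.range j, k i ≤ j := fun j =>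
    (Finset.sum_le_card_nsmul _ _ 1 fun i _ => hk i).trans (by simp)
  refine Terminates.of_le (Terminates.cons
    (.of_safe (Q := fun t => Same s t ∧ t.mem = s.mem ∧ t.reg 13 = 0) ?_ ?_)
    fun s' ⟨hss, hmem, h13⟩ => Terminates.cons (Terminates.innerLoop (m := 2 * n)
    (fun i t => MemIs n N A r p (prefixed i (fun j => ∑ i ∈ Finset.range j, k i) k) t.mem ∧
      t.reg 13 = ∑ j ∈ Finset.range i, k j)
    (by omega) (by omega) (hl.of_same hss).r8 (hl.of_same hss).r7 (fun i t x h => ?_)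
    (fun i hi t hst ht h12 => ?_)
    ⟨by simpa [hmem] using hm, by simpa using h13⟩) fun t ht => .nil ⟨hss.trans ht.1,
      ht.2.1.congr (fun _ _ => rfl) (fun _ _ => rfl) (fun v hv => prefixed_of_lt _ _ hv)⟩) ?_
  · simp [Prog.Safe]; omega
  · simp [Prog.run, same_setReg, Same.refl]
  · simpa using h
  · have hlt := (hl.of_same hss).of_same hst
    obtain ⟨ht, h13'⟩ := ht
    have hki := ht.mark i hi
    have hki' := hk i
    have hsum := hle i
    rw [prefixed_self] at hki
    simp [Prog.Safe, Prog.run, block, ArithOp.eval, h12, hlt.r5, same_setReg,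
      Same.refl, hki, h13', Finset.sum_range_succ]
    refine ⟨⟨by omega, by omega, by omega, by omega⟩, ?_⟩
    rw [← update_prefixed]
    exact ht.set_mark hs hi _
  · simp only [Prog.cost, block]; omega

/-- Look up the ranks in the table of marks. -/
def lookUp : Prog := forLoop 12 0 (block [.arith .add 15 3 12, .load 16 15, .arith .add 16 16 5,
  .load 16 16, .store 15 16])

theorem terminates_lookUp (hs : Sizes n N W) (hl : Layout n N s)
    (hm : MemIs n N A r p k s.mem) (hr : ∀ v < n, r v < 2 * n) (hk : ∀ j, k j ≤ j) :
    Terminates W lookUp s (40 * n) fun t => Same s t ∧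
      MemIs n N A (fun v => k (r v)) p k t.mem := by
  have h1 := hs.le
  have h2 := hs.one_lt
  have h3 := hs.word
  refine (Terminates.innerLoop (m := n)
    (fun i t => MemIs n N A (prefixed i (fun v => k (r v)) r) p k t.mem)
    (by omega) (by omega) hl.r0 hl.r7 (fun _ _ _ h => h) (fun i hi t hst ht h12 => ?_)
    (by simpa using hm)).mono ?_ fun t ht => ⟨ht.1, ht.2.congr
      (fun v hv => prefixed_of_lt _ _ hv) (fun _ _ => rfl) (fun _ _ => rfl)⟩
  · have hlt := hl.of_same hst
    have hri := ht.rank i hi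
    have hri' := hr i hi
    have hki := ht.mark _ hri'
    have hki' := hk (r i)
    rw [prefixed_self] at hri
    simp [Prog.Safe, Prog.run, block, ArithOp.eval, h12, hlt.r3, hlt.r5, same_setReg, Same.refl,
      hri, add_comm (r i), hki]
    refine ⟨⟨by omega, by omega, by omega, by omega⟩, ?_⟩
    rw [← update_prefixed]
    exact ht.set_rank hs hi _
  · simp only [Prog.cost, block]; omega

/-- Set all marks to zero. -/
def clearMarks : Prog := forLoop 12 8 (block [.arith .add 15 5 12, .store 15 6])

theorem terminates_clearMarks (hs : Sizes n N W) (hl : Layout n N s)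
    (hm : MemIs n N A r p k s.mem) :
    Terminates W clearMarks s (40 * n) fun t => Same s t ∧ MemIs n N A r p 0 t.mem := by
  have h1 := hs.le
  have h2 := hs.one_lt
  have h3 := hs.word
  refine (Terminates.innerLoop (m := 2 * n) (fun i t => MemIs n N A r p (prefixed i 0 k) t.mem)
    (by omega) (by omega) hl.r8 hl.r7 (fun _ _ _ h => h) (fun i hi t hst ht h12 => ?_)
    (by simpa using hm)).mono ?_ fun t ht => ⟨ht.1, ht.2.congr (fun _ _ => rfl)
      (fun _ _ => rfl) (fun v hv => prefixed_of_lt _ _ hv)⟩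
  · have hlt := hl.of_same hst
    simp [Prog.Safe, Prog.run, block, ArithOp.eval, h12, hlt.r5, hlt.r6, same_setReg, Same.refl]
    refine ⟨⟨by omega, by omega⟩, ?_⟩
    rw [← update_prefixed]
    exact ht.set_mark hs hi 0
  · simp only [Prog.cost, block]; omega

/-- Visit an unvisited vertex of largest rank, at the position in register `9`, and renumber
the ranks. -/
def visitStep : Prog := block [findBest,
  block [.arith .add 10 14 6, .arith .add 15 4 10, .store 15 9],
  setKeys, setMarks, sumMarks, lookUp, clearMarks]

/-- Six linear loops. Renumbering uses a table of occurring keys rather than sorting by comparisons,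
and the table is cleared for the next visit. -/
theorem terminates_visitStep (hs : Sizes n N W) (hl : Layout n N s)
    (hm : MemIs n N A r p 0 s.mem) (hr : ∀ v < n, r v < n) (hp : ∀ v < n, p v ≤ n)
    (hA : ∀ a, A a ≤ 1) {t : ℕ} (ht : t < n) (h9 : s.reg 9 = t) (hex : ∃ v < n, p v = n) :
    Terminates W visitStep s (250 * n) fun s' => Layout n N s' ∧ s'.reg 9 = t ∧
      ∃ b < n, s'.reg 10 = b ∧ p b = n ∧ (∀ v < n, p v = n → r v ≤ r b) ∧
        MemIs n N A (fun v => countKeys (fun v : Fin n => 2 * r v + A (b * n + v))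
          (2 * r v + A (b * n + v))) (Function.update p b t) 0 s'.mem := by
  classical
  have h1 := hs.le
  have h2 := hs.one_lt
  have h3 := hs.word
  refine Terminates.of_le
    (c := 40 * n + (3 + 1 + (40 * n + (40 * n + (40 * n + (40 * n + (40 * n + 1))))))) ?_ (by omega)
  refine .cons (terminates_findBest hs hl hm hr hp) fun s₁ ⟨e₁, m₁, b₁⟩ => ?_
  obtain ⟨b, hb, hpb, hbest, h14⟩ : ∃ b < n, p b = n ∧ (∀ v < n, p v = n → r v ≤ r b) ∧
      s₁.reg 14 = b := by
    obtain ⟨v, hv, hvn⟩ := hex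
    rcases b₁.2 with h | ⟨hlt, hpb, h13⟩
    · have := b₁.1 v hv hvn
      omega
    · refine ⟨_, hlt, hpb, fun u hu hun => ?_, rfl⟩
      have := b₁.1 u hu hun
      omega
  have hl₁ := hl.of_same e₁
  have h9₁ : s₁.reg 9 = t := (e₁ 9 (by omega)).trans h9
  refine .cons (.of_safe (Q := fun s₂ => Layout n N s₂ ∧ s₂.reg 9 = t ∧ s₂.reg 10 = b ∧
    MemIs n N A r (Function.update p b t) 0 s₂.mem) ?_ ?_) fun s₂ ⟨hl₂, h9₂, h10, m₂⟩ => ?_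
  · simp [Prog.Safe, Prog.run, block, ArithOp.eval, h14, hl₁.r6, hl₁.r4, h9₁]
    omega
  · simp [Prog.run, block, ArithOp.eval, h14, hl₁.r6, hl₁.r4, h9₁]
    exact ⟨⟨by simpa using hl₁.r0, by simpa using hl₁.r2, by simpa using hl₁.r3,
      by simpa using hl₁.r4, by simpa using hl₁.r5, by simpa using hl₁.r6,
      by simpa using hl₁.r7, by simpa using hl₁.r8⟩, m₁.set_pos hs hb t⟩
  -- Ranks below `n` keep the keys within the table of marks; the counting brings them back below
  -- `n`.
  have hkey : ∀ v < n, 2 * r v + A (b * n + v) < 2 * n := fun v hv => by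
    have := hr v hv
    have := hA (b * n + v)
    omega
  refine .cons (terminates_setKeys hs hl₂ m₂ hr hA hb h10) fun s₃ ⟨e₃, m₃⟩ => ?_
  have hl₃ := hl₂.of_same e₃
  refine .cons (terminates_setMarks hs hl₃ m₃ hkey) fun s₄ ⟨e₄, m₄⟩ => ?_
  have hl₄ := hl₃.of_same e₄
  refine .cons (terminates_sumMarks hs hl₄ m₄ fun j => by split_ifs <;> omega)
    fun s₅ ⟨e₅, m₅⟩ => ?_
  have hl₅ := hl₄.of_same e₅
  -- A partial sum of marks counts the key values below `j`.
  have hcount : ∀ j, ∑ i ∈ Finset.range j,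
      (if ∃ v : Fin n, 2 * r v + A (b * n + v) = i then 1 else 0) =
      countKeys (fun v : Fin n => 2 * r v + A (b * n + v)) j := by
    intro j
    rw [countKeys, Finset.card_filter]
    refine Finset.sum_congr rfl fun i _ => ?_
    congr
  refine .cons (terminates_lookUp hs hl₅ m₅ hkey fun j => ?_) fun s₆ ⟨e₆, m₆⟩ => ?_
  · exact (Finset.sum_le_card_nsmul _ _ 1 fun i _ => by split_ifs <;> omega).trans (by simp)
  have hl₆ := hl₅.of_same e₆
  refine .cons (terminates_clearMarks hs hl₆ m₆) fun s₇ ⟨e₇, m₇⟩ => .nil ?_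
  have e := e₃.trans (e₄.trans (e₅.trans (e₆.trans e₇)))
  exact ⟨hl₂.of_same e, (e 9 (by omega)).trans h9₂, b, hb, (e 10 (by omega)).trans h10, hpb, hbest,
    m₇.congr (fun v _ => hcount _) (fun _ _ => rfl) fun _ _ => rfl⟩

/-- `A` is the adjacency matrix of `G`, stored row by row. -/
structure IsMatrix (G : SimpleGraph (Fin n)) (A : ℕ → ℕ) : Prop where
  le_one : ∀ a, A a ≤ 1
  adj : ∀ i v : Fin n, G.Adj i v → A (i * n + v) = 1
  not_adj : ∀ i v : Fin n, ¬ G.Adj i v → A (i * n + v) = 0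

/-- A lexicographic search from `x` has visited `t` vertices, the last one is in register `10`. -/
def SearchInvariant (G : SimpleGraph (Fin n)) (x : Fin n) (N : ℕ) (A : ℕ → ℕ) (t : ℕ)
    (s : State) : Prop :=
  Layout n N s ∧ ∃ r p, MemIs n N A r p 0 s.mem ∧ (∀ v < n, r v < n) ∧
    RankInvariant G x n t (fun v => p v) (fun v => r v) ∧
    (0 < t → ∃ b : Fin n, s.reg 10 = b ∧ p b + 1 = t)

/-- A lexicographic breadth-first search from the vertex in register `10`. -/
def lexSearch : Prog := block [initRanks, initPositions,
  block [.arith .add 13 3 10, .store 13 7], forLoop 9 0 visitStep]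

theorem terminates_lexSearch {G : SimpleGraph (Fin n)} (hs : Sizes n N W) (hl : Layout n N s)
    (hA : IsMatrix G A) (hm : MemIs n N A r p 0 s.mem) {x : Fin n} (hx : s.reg 10 = x) :
    Terminates W lexSearch s (350 * N) (SearchInvariant G x N A n) := by
  have h1 := hs.le
  have h2 := hs.one_lt
  have h3 := hs.word
  refine Terminates.of_le (c := 40 * n + (40 * n + (2 + 1 + (n * (250 * n + 2) + 2 + 1)))) ?_ ?_
  swap
  · have : n * (250 * n + 2) = 250 * N + 2 * n := by rw [hs.sq]; ring
    omega
  refine .cons (terminates_initRanks hs hl hm) fun s₁ ⟨e₁, m₁⟩ => ?_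
  refine .cons (terminates_initPositions hs (hl.of_same e₁) m₁) fun s₂ ⟨e₂, m₂⟩ => ?_
  have e := e₁.trans e₂
  have hl₂ := hl.of_same e
  have hx₂ : s₂.reg 10 = x := (e 10 (by omega)).trans hx
  refine .cons (.of_safe (Q := fun s₃ => Layout n N s₃ ∧
    MemIs n N A (Function.update 0 x 1) (fun _ => n) 0 s₃.mem) ?_ ?_) fun s₃ ⟨hl₃, m₃⟩ => ?_
  · simp [Prog.Safe, Prog.run, block, ArithOp.eval, hx₂, hl₂.r3, hl₂.r7]
    omega
  · refine ⟨hl₂.of_same ?_, ?_⟩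
    · simp [Prog.run, block, same_setReg, Same.refl]
    · simpa [Prog.run, block, ArithOp.eval, hx₂, hl₂.r3, hl₂.r7] using m₂.set_rank hs x.2 1
  refine .cons (Terminates.forLoop (SearchInvariant G x N A) (by omega) (fun t s' z h => ?_)
    (fun t s' h => ⟨h.1.r0, h.1.r7⟩) (fun t ht s' h h9 => ?_) ⟨hl₃, _, _, m₃, fun v hv => ?_,
      .zero (fun _ => rfl) (by simp) fun v hv => ?_, fun h => absurd h (lt_irrefl 0)⟩)
    fun s₄ h => .nil h
  · obtain ⟨hl', r', p', hm', hr', hR, h10⟩ := h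
    exact ⟨⟨by simpa using hl'.r0, by simpa using hl'.r2, by simpa using hl'.r3,
      by simpa using hl'.r4, by simpa using hl'.r5, by simpa using hl'.r6,
      by simpa using hl'.r7, by simpa using hl'.r8⟩, r', p', hm', hr', hR, by simpa using h10⟩
  · obtain ⟨hl', r', p', hm', hr', hR, -⟩ := h
    have hp' : ∀ v < n, p' v ≤ n := fun v hv => by
      have := hR.lt_or_eq ⟨v, hv⟩
      dsimp only at this
      omega
    obtain ⟨u, hu⟩ := hR.exists_unvisited (Fintype.card_fin n) ht
    refine (terminates_visitStep hs hl' hm' hr' hp' hA.le_one ht h9 ⟨u, u.2, hu⟩).mono le_rfl ?_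
    rintro s'' ⟨hl'', h9'', b, hb, h10, hpb, hbest, hm''⟩
    refine ⟨⟨hl'', _, _, hm'', fun v hv => ?_, ?_, fun _ => ⟨⟨b, hb⟩, h10, by simp⟩⟩, h9''⟩
    · exact (countKeys_lt_card (fun v : Fin n => 2 * r' v + A (b * n + v)) ⟨v, hv⟩).trans_eq
        (Fintype.card_fin n)
    · have := hR.step_countKeys (b := ⟨b, hb⟩)
        (key := fun v : Fin n => 2 * r' v + A (b * n + v)) ht hpb (fun v hv => hbest v v.2 hv)
        (fun v hv => by rw [hA.adj ⟨b, hb⟩ v hv]) (fun v hv => by rw [hA.not_adj ⟨b, hb⟩ v hv]; rfl)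
      convert this using 2 with v
      simp [Function.update_apply, Fin.ext_iff]
  -- The start has rank one, which is below `n` because `1 < n`.
  · by_cases hvx : v = x
    · subst hvx; simp; omega
    · rw [Function.update_of_ne hvx]; exact (Nat.zero_le _).trans_lt hv
  · rw [Function.update_of_ne fun h => hv (Fin.ext h)]; rfl

end Search

/-! ### Writing the bags and assembling the algorithm -/

section Output

variable {n N W : ℕ} {A r p k m : ℕ → ℕ} {s : State}

/-- The last position of `w` and of its neighbours among the first `i` vertices. -/
def spanEnd (n : ℕ) (A p : ℕ → ℕ) (i w : ℕ) : ℕ :=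
  p w ⊔ (Finset.range i).sup fun v => A (w * n + v) * p v

theorem spanEnd_succ (i w : ℕ) :
    spanEnd n A p (i + 1) w = max (spanEnd n A p i w) (A (w * n + i) * p i) := by
  simp only [spanEnd, Finset.range_add_one, Finset.sup_insert]
  omega

/-- A non-neighbour contributes the product `0`, which cannot reach a positive `j`; for `j = 0` both
sides hold trivially. -/
theorem le_spanEnd_iff {G : SimpleGraph (Fin n)} (hA : IsMatrix G A) (w : Fin n) (j : ℕ) :
    j ≤ spanEnd n A p n w ↔ j ≤ p w ∨ ∃ v, G.Adj w v ∧ j ≤ p v := by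
  rcases j.eq_zero_or_pos with rfl | hj
  · simp
  rw [spanEnd, le_sup_iff, Finset.le_sup_iff hj]
  refine or_congr_right ⟨?_, ?_⟩
  · rintro ⟨v, hv, hle⟩
    refine ⟨⟨v, Finset.mem_range.1 hv⟩, ?_⟩
    by_cases h : G.Adj w ⟨v, Finset.mem_range.1 hv⟩
    · rw [hA.adj w ⟨v, _⟩ h, one_mul] at hle
      exact ⟨h, hle⟩
    · rw [hA.not_adj w ⟨v, _⟩ h] at hle
      omega
  · rintro ⟨v, h, hle⟩
    exact ⟨v, Finset.mem_range.2 v.2, by rwa [hA.adj w v h, one_mul]⟩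

theorem spanEnd_le (hA : ∀ a, A a ≤ 1) (hp : ∀ v < n, p v ≤ n) {i w : ℕ} (hi : i ≤ n)
    (hw : w < n) : spanEnd n A p i w ≤ n := by
  refine sup_le (hp w hw) (Finset.sup_le fun v hv => ?_)
  exact (Nat.mul_le_mul (hA _) (hp v ((Finset.mem_range.1 hv).trans_le hi))).trans_eq (one_mul n)

/-- Replace the rank of every vertex by the last position of its closed neighbourhood. -/
def setEnds : Prog := forLoop 9 0 (block [block [.arith .add 15 4 9, .load 13 15],
  forLoop 12 0 (block [.arith .mul 15 9 0, .arith .add 15 15 12, .load 15 15,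
    .arith .add 16 4 12, .load 16 16, .arith .mul 16 16 15,
    .branch 13 16 (.arith .add 13 16 6) .skip]),
  block [.arith .add 15 3 9, .store 15 13]])

theorem Layout.setReg_nine (hl : Layout n N s) (x : ℕ) : Layout n N (s.setReg 9 x) :=
  ⟨by simpa using hl.r0, by simpa using hl.r2, by simpa using hl.r3, by simpa using hl.r4,
    by simpa using hl.r5, by simpa using hl.r6, by simpa using hl.r7, by simpa using hl.r8⟩

theorem terminates_setEnds (hs : Sizes n N W) (hl : Layout n N s)
    (hm : MemIs n N A r p k s.mem) (hA : ∀ a, A a ≤ 1) (hp : ∀ v < n, p v ≤ n) :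
    Terminates W setEnds s (60 * N) fun t => Layout n N t ∧
      MemIs n N A (spanEnd n A p n) p k t.mem := by
  have h1 := hs.le
  have h2 := hs.one_lt
  have h3 := hs.word
  refine (Terminates.forLoop (c := 2 + 1 + (20 * n + (2 + 1 + 1)))
    (fun w t => Layout n N t ∧ MemIs n N A (prefixed w (spanEnd n A p n) r) p k t.mem) (m := n)
    (by omega) (fun w t x h => ⟨h.1.setReg_nine x, h.2⟩) (fun w t h => ⟨h.1.r0, h.1.r7⟩)
    (fun w hw t ⟨hl', hm'⟩ h9 => ?_) ⟨hl, by simpa using hm⟩).mono ?_ fun t ht => ⟨ht.1,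
      ht.2.congr (fun v hv => prefixed_of_lt _ _ hv) (fun _ _ => rfl) (fun _ _ => rfl)⟩
  · have hpw := hm'.pos w hw
    have hpw' := hp w hw
    refine .cons (.of_safe (Q := fun t₁ => Same t t₁ ∧ t₁.mem = t.mem ∧ t₁.reg 13 = p w) ?_ ?_)
      fun t₁ ⟨e₁, hm₁, h13⟩ => ?_
    · simp [Prog.Safe, Prog.run, block, ArithOp.eval, hl'.r4, h9, hpw]
      omega
    · simp [Prog.run, block, ArithOp.eval, hl'.r4, h9, hpw, same_setReg, Same.refl]
    have hl₁ := hl'.of_same e₁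
    have h9₁ : t₁.reg 9 = w := (e₁ 9 (by omega)).trans h9
    refine .cons ((Terminates.innerLoop (m := n)
      (fun i u => u.mem = t.mem ∧ u.reg 13 = spanEnd n A p i w) (by omega) (by omega)
      hl₁.r0 hl₁.r7 (fun i u x h => by simpa using h) (fun i hi u hu ⟨hmu, h13u⟩ h12 => ?_)
      ⟨hm₁, by simp [h13, spanEnd]⟩).of_le ?_) fun t₂ ⟨e₂, hm₂, h13₂⟩ => ?_
    · have hlu := hl₁.of_same hu
      have h9u : u.reg 9 = w := (hu 9 (by omega)).trans h9₁
      have hi' := hs.index_lt hw hi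
      have hadj := hm'.adj _ hi'
      have hA' := hA (w * n + i)
      have hpi := hm'.pos i hi
      have hpi' := hp i hi
      have hle := spanEnd_le hA hp hi.le hw
      have hmul : p i * A (w * n + i) ≤ n := (Nat.mul_le_mul hpi' hA').trans_eq (mul_one n)
      by_cases hc : spanEnd n A p i w < p i * A (w * n + i)
      · simp [Prog.Safe, Prog.run, block, ArithOp.eval, h12, hlu.r0, hlu.r4, hlu.r6, h9u,
          same_setReg, Same.refl, hmu, hadj, hpi, h13u, hc, spanEnd_succ]
        rw [mul_comm (A _)]
        omega
      · simp [Prog.Safe, Prog.run, block, ArithOp.eval, h12, hlu.r0, hlu.r4, h9u,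
          same_setReg, Same.refl, hmu, hadj, hpi, h13u, hc, spanEnd_succ]
        rw [mul_comm (A _)]
        omega
    · simp only [Prog.cost, block]; omega
    have hl₂ := hl₁.of_same e₂
    have h9₂ : t₂.reg 9 = w := (e₂ 9 (by omega)).trans h9₁
    have hle := spanEnd_le hA hp le_rfl hw
    refine .cons (.of_safe (Q := fun t₃ => (Layout n N t₃ ∧
      MemIs n N A (prefixed (w + 1) (spanEnd n A p n) r) p k t₃.mem) ∧ t₃.reg 9 = w) ?_ ?_)
      fun t₃ h => .nil h
    · simp [Prog.Safe, Prog.run, block, ArithOp.eval, hl₂.r3, h9₂, h13₂]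
      omega
    · refine ⟨⟨hl₂.of_same ?_, ?_⟩, ?_⟩
      · simp [Prog.run, block, same_setReg, Same.refl]
      · simp [Prog.run, block, ArithOp.eval, hl₂.r3, h9₂, h13₂, hm₂]
        rw [← update_prefixed]
        exact hm'.set_rank hs hw _
      · simp [Prog.run, block, h9₂]
  · have : n * (2 + 1 + (20 * n + (2 + 1 + 1)) + 2) = 20 * N + 9 * n := by rw [hs.sq]; ring
    omega

/-- The entries of the rows before the `i`-th row, and the first `j` entries of that row, are
written. -/
def Written (n N : ℕ) (B : ℕ → ℕ → ℕ) (i j : ℕ) (m : ℕ → ℕ) : Prop :=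
  (∀ i' < i, ∀ v < n, m (4 * N + i' * n + v) = B i' v) ∧
    ∀ v < j, m (4 * N + i * n + v) = B i v

theorem Written.set {B : ℕ → ℕ → ℕ} {i j : ℕ} (h : Written n N B i j m) (hj : j < n) :
    Written n N B i (j + 1) (Function.update m (4 * N + i * n + j) (B i j)) := by
  refine ⟨fun i' hi' v hv => ?_, fun v hv => ?_⟩
  · have : (i' + 1) * n ≤ i * n := Nat.mul_le_mul_right n hi'
    rw [Nat.succ_mul] at this
    rw [Function.update_of_ne (by omega), h.1 i' hi' v hv]
  · rcases (Nat.lt_succ_iff.1 hv).eq_or_lt with rfl | hv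
    · rw [Function.update_self]
    · rw [Function.update_of_ne (by omega), h.2 v hv]

theorem Written.next {B : ℕ → ℕ → ℕ} {i : ℕ} (h : Written n N B i n m) :
    Written n N B (i + 1) 0 m := by
  refine ⟨fun i' hi' v hv => ?_, fun v hv => absurd hv (Nat.not_lt_zero v)⟩
  rcases (Nat.lt_succ_iff.1 hi').eq_or_lt with rfl | hi'
  · exact h.2 v hv
  · exact h.1 i' hi' v hv

/-- Write the incidence matrix of the bags. -/
def writeBags : Prog := forLoop 9 0 (block [block [.arith .mul 11 9 0, .arith .add 11 2 11],
  forLoop 12 0 (block [.const 16 0, .arith .add 15 4 12, .load 15 15,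
    .branch 9 15 .skip (block [.arith .add 15 3 12, .load 15 15,
      .branch 15 9 .skip (.const 16 1)]),
    .arith .add 15 11 12, .store 15 16])])

theorem terminates_writeBags (hs : Sizes n N W) (hl : Layout n N s)
    (hm : MemIs n N A r p k s.mem) (hp : ∀ v < n, p v ≤ n) (hr : ∀ v < n, r v ≤ n) :
    Terminates W writeBags s (60 * N) fun t => Layout n N t ∧
      Written n N (fun i v => if p v ≤ i ∧ i ≤ r v then 1 else 0) n 0 t.mem := by
  have h1 := hs.le
  have h2 := hs.one_lt
  have h3 := hs.word
  refine (Terminates.forLoop (c := 2 + 1 + (20 * n + 1))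
    (fun i t => Layout n N t ∧ MemIs n N A r p k t.mem ∧
      Written n N (fun i v => if p v ≤ i ∧ i ≤ r v then 1 else 0) i 0 t.mem) (m := n)
    (by omega) (fun w t x h => ⟨h.1.setReg_nine x, h.2⟩) (fun w t h => ⟨h.1.r0, h.1.r7⟩)
    (fun i hi t ⟨hl', hm', hw'⟩ h9 => ?_) ⟨hl, hm, by simp [Written]⟩).mono ?_
    fun t ht => ⟨ht.1, ht.2.2⟩
  · have hin : i * n < N := by simpa using hs.index_lt hi (by omega : 0 < n)
    refine .cons (.of_safe (Q := fun t₁ => Layout n N t₁ ∧ t₁.mem = t.mem ∧ t₁.reg 9 = i ∧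
      t₁.reg 11 = 4 * N + i * n) ?_ ?_) fun t₁ ⟨hl₁, hm₁, h9₁, h11⟩ => ?_
    · simp [Prog.Safe, Prog.run, block, ArithOp.eval, hl'.r0, hl'.r2, h9]
      omega
    · refine ⟨⟨?_, ?_, ?_, ?_, ?_, ?_, ?_, ?_⟩, ?_⟩ <;> simp [Prog.run, block, ArithOp.eval,
        hl'.r0, hl'.r2, hl'.r3, hl'.r4, hl'.r5, hl'.r6, hl'.r7, hl'.r8, h9]
    refine .cons ((Terminates.innerLoop (m := n)
      (fun j u => MemIs n N A r p k u.mem ∧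
        Written n N (fun i v => if p v ≤ i ∧ i ≤ r v then 1 else 0) i j u.mem) (by omega)
      (by omega) hl₁.r0 hl₁.r7 (fun i u x h => h) (fun j hj u hu ⟨hmu, hwu⟩ h12 => ?_)
      ⟨hm₁ ▸ hm', hm₁ ▸ hw'⟩).of_le ?_)
      fun t₂ ⟨e₂, hm₂, hw₂⟩ => .nil ⟨⟨hl₁.of_same e₂, hm₂, hw₂.next⟩,
        (e₂ 9 (by omega)).trans h9₁⟩
    · have hlu := hl₁.of_same hu
      have h9u : u.reg 9 = i := (hu 9 (by omega)).trans h9₁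
      have h11u : u.reg 11 = 4 * N + i * n := (hu 11 (by omega)).trans h11
      have hij := hs.index_lt hi hj
      have hpj := hmu.pos j hj
      have hpj' := hp j hj
      have hrj := hmu.rank j hj
      have hrj' := hr j hj
      have hset := hwu.set hj
      have hmem := fun x => hmu.set_out hs (a := 4 * N + i * n + j) (by omega) x
      -- At bag `i`, vertex `j` has not yet entered, has already left, or is present.
      by_cases hc : i < p j
      · simp only [show ¬ (p j ≤ i ∧ i ≤ r j) by omega, if_false] at hset
        simp [Prog.Safe, Prog.run, block, ArithOp.eval, h12, hlu.r4, h9u, h11u,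
          same_setReg, Same.refl, hpj, hc]
        exact ⟨by omega, hmem 0, hset⟩
      · by_cases hc' : r j < i
        · simp only [show ¬ (p j ≤ i ∧ i ≤ r j) by omega, if_false] at hset
          simp [Prog.Safe, Prog.run, block, ArithOp.eval, h12, hlu.r3, hlu.r4, h9u, h11u,
            same_setReg, Same.refl, hpj, hrj, hc, hc']
          exact ⟨by omega, hmem 0, hset⟩
        · simp only [show p j ≤ i ∧ i ≤ r j by omega, if_true, and_self] at hset
          simp [Prog.Safe, Prog.run, block, ArithOp.eval, h12, hlu.r3, hlu.r4, h9u, h11u,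
            same_setReg, Same.refl, hpj, hrj, hc, hc']
          exact ⟨by omega, hmem 1, hset⟩
    · simp only [Prog.cost, block]; omega
  · have : n * (2 + 1 + (20 * n + 1) + 2) = 20 * N + 6 * n := by rw [hs.sq]; ring
    omega

/-- Set the parameters. -/
def setUp : Prog := block [.const 7 1, .arith .mul 3 0 0, .arith .add 4 3 3, .arith .add 5 4 3,
  .arith .add 2 5 3, .arith .add 8 0 0]

/-- Compute a path-decomposition of length at most two of an AT-free graph. -/
def decompose : Prog := block [setUp, lexSearch, lexSearch, setEnds, writeBags, .arith .add 1 0 6]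

theorem inputState_isMatrix (G : SimpleGraph (Fin n)) : IsMatrix G (inputState G).mem := by
  -- The input is defined through some representation of the address as `i * n + v`; division with
  -- remainder makes it unique.
  have key : ∀ i v i' v' : Fin n, (i * n + v : ℕ) = i' * n + v' → i = i' ∧ v = v' := by
    intro i v i' v' h
    have hn : 0 < n := i.pos
    have hv := congrArg (· % n) h
    have hi := congrArg (· / n) h
    simp only [Nat.mul_add_mod_self_right, Nat.mod_eq_of_lt v.2, Nat.mod_eq_of_lt v'.2] at hv
    simp only [Nat.add_div_of_dvd_right (Dvd.intro_left _ rfl), Nat.mul_div_cancel _ hn,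
      Nat.div_eq_of_lt v.2, Nat.div_eq_of_lt v'.2] at hi
    exact ⟨Fin.ext (by omega), Fin.ext hv⟩
  refine ⟨fun a => ?_, fun i v h => ?_, fun i v h => ?_⟩
  · simp only [inputState]
    split_ifs <;> omega
  · exact if_pos ⟨i, v, rfl, h⟩
  · refine if_neg ?_
    rintro ⟨i', v', he, h'⟩
    obtain ⟨rfl, rfl⟩ := key _ _ _ _ he
    exact h h'

theorem exists_exec_decompose (hn : 1 < n) (G : SimpleGraph (Fin n)) (hG : G.Connected)
    (hAT : IsATFree G) : ∃ (t : State) (c : ℕ) (P : PathDecomposition G),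
      Exec (n ^ 6) decompose (inputState G) t c ∧ c ≤ 1000 * n ^ 2 ∧ t.Holds P ∧
        P.length ≤ 2 := by
  obtain ⟨N, hN⟩ : ∃ N, N = n * n := ⟨_, rfl⟩
  -- The exponent `6` comes from `16 ≤ n ^ 4`, valid for `n ≥ 2`, times `N = n ^ 2`.
  have hs : Sizes n N (n ^ 6) := by
    refine ⟨hn, hN, ?_⟩
    calc 16 * N = 2 ^ 4 * n ^ 2 := by rw [hN]; ring
      _ ≤ n ^ 4 * n ^ 2 := Nat.mul_le_mul_right _ (Nat.pow_le_pow_left hn 4)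
      _ = n ^ 6 := by ring
  have h1 := hs.le
  have h3 := hs.word
  have hA := inputState_isMatrix G
  let Q : State → Prop := fun t => ∃ P : PathDecomposition G, t.Holds P ∧ P.length ≤ 2
  suffices H : Terminates (n ^ 6) decompose (inputState G) (1000 * N) Q by
    obtain ⟨t, c, he, hc, P, hP, hP'⟩ := H
    exact ⟨t, c, P, he, by rwa [sq, ← hN], hP, hP'⟩
  refine Terminates.of_le (c := 6 + 1 + (350 * N + (350 * N + (60 * N + (60 * N + (1 + 1)))))) ?_
    (by omega)
  refine .cons (.of_safe (Q := fun s => Layout n N s ∧ s.mem = (inputState G).mem ∧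
    s.reg 10 = 0) ?_ ?_) fun s₁ ⟨hl₁, hm₁, h10⟩ => ?_
  · simp [Prog.Safe, Prog.run, setUp, block, ArithOp.eval, inputState, ← hN]
    omega
  · refine ⟨⟨?_, ?_, ?_, ?_, ?_, ?_, ?_, ?_⟩, ?_, ?_⟩ <;>
      simp [Prog.run, setUp, block, ArithOp.eval, inputState, ← hN] <;> omega
  -- Ranks and positions may start arbitrary, since the search initializes them. The marks must be
  -- zero, and they are, lying beyond the input matrix.
  have hm : MemIs n N (inputState G).mem (fun v => s₁.mem (N + v)) (fun v => s₁.mem (2 * N + v)) 0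
      s₁.mem := by
    refine ⟨fun a _ => by rw [hm₁], fun _ _ => rfl, fun _ _ => rfl, fun j _ => ?_⟩
    rw [hm₁]
    refine if_neg ?_
    rintro ⟨i, v, he, -⟩
    have := hs.index_lt i.2 v.2
    omega
  refine .cons (terminates_lexSearch hs hl₁ hA hm (x := ⟨0, by omega⟩) h10)
    fun s₂ ⟨hl₂, r₂, p₂, m₂, _, hR₂, hlast⟩ => ?_
  -- Register `10` still holds the last visited vertex, at position `n - 1`, and the second search
  -- starts there.
  obtain ⟨x, hx, hpx⟩ := hlast (by omega)
  refine .cons (terminates_lexSearch hs hl₂ hA m₂ hx)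
    fun s₃ ⟨hl₃, r₃, p₃, m₃, _, hR₃, _⟩ => ?_
  have hcard := Fintype.card_fin n
  have hp₃ : ∀ v < n, p₃ v < n := fun v hv => hR₃.lt_card hcard ⟨v, hv⟩
  have hadm := hR₂.isAdmissibleOrder hAT hcard (x := x)
    (fun y => by have := hR₂.lt_card hcard y; omega) hR₃
  refine .cons (terminates_setEnds hs hl₃ m₃ hA.le_one fun v hv => (hp₃ v hv).le)
    fun s₄ ⟨hl₄, m₄⟩ => ?_
  refine .cons (terminates_writeBags hs hl₄ m₄ (fun v hv => (hp₃ v hv).le) fun v hv =>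
    spanEnd_le hA.le_one (fun v hv => (hp₃ v hv).le) le_rfl hv) fun s₅ ⟨hl₅, hw⟩ => ?_
  refine .cons (.of_safe (Q := Q) ?_ ?_) fun s₆ h => .nil h
  · simp [Prog.Safe, ArithOp.eval, hl₅.r0, hl₅.r6]
    omega
  · refine ⟨spanDecomposition G (fun v => p₃ v) n fun v => hp₃ v v.2,
      ⟨le_rfl, by simp [Prog.run, ArithOp.eval, hl₅.r0, hl₅.r6, spanDecomposition], fun i v => ?_⟩,
      hadm.length_spanDecomposition_le hG n _⟩
    have hent := hw.1 i i.2 v v.2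
    have hmem : v ∈ (spanDecomposition G (fun v => p₃ v) n fun v => hp₃ v v.2).bag i ↔
        p₃ v ≤ i ∧ i ≤ spanEnd n (inputState G).mem p₃ n v := by
      rw [le_spanEnd_iff hA]
      rfl
    rw [hmem]
    simp only [Prog.run, State.setReg_mem, State.setReg_reg]
    rw [if_neg (by omega), hl₅.r2, hent]
    exact ⟨fun h => if_pos h, fun h => if_neg h⟩

end Output
end ATFree

theorem proposition6p3 :
    -- the bounds on path-breadth and path-length
    (∀ (V : Type*) [Fintype V] [Nontrivial V] (G : SimpleGraph V),
      G.Connected → ATFree.IsATFree G →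
        ATFree.pathBreadth G ≤ ATFree.pathLength G ∧ ATFree.pathLength G ≤ 2) ∧
    -- one program computes a path-decomposition of length at most 2 in quadratic time, on words
    -- of logarithmically many bits
    (∃ (p : ATFree.Prog) (k C : ℕ), ∀ (n : ℕ), 1 < n → ∀ G : SimpleGraph (Fin n),
      G.Connected → ATFree.IsATFree G →
        ∃ (t : ATFree.State) (c : ℕ) (P : ATFree.PathDecomposition G),
          ATFree.Exec (n ^ k) p (ATFree.inputState G) t c ∧ c ≤ C * n ^ 2 ∧
          t.Holds P ∧ P.length ≤ 2) ∧
    -- the graph built from the layering of a second lexicographic breadth-first search, started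
    -- at the last vertex of a first one, is an interval graph between the graph and its square
    (∀ (V : Type*) [Fintype V] [Nontrivial V] (G : SimpleGraph V),
      G.Connected → ATFree.IsATFree G →
        ∀ (s x : V) (τ σ : V → ℕ),
          ATFree.IsLBFSOrdering G s τ → τ x = 1 → ATFree.IsLBFSOrdering G x σ →
            G ≤ ATFree.plusGraph G x σ ∧ ATFree.plusGraph G x σ ≤ ATFree.square G ∧
              ATFree.IsIntervalGraph (ATFree.plusGraph G x σ)) := by
  refine ⟨fun V _ _ G hG hAT => ⟨ATFree.pathBreadth_le_pathLength G,
    ATFree.pathLength_le_two hG hAT⟩, ⟨ATFree.decompose, 6, 1000, fun n hn G hG hAT =>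
      ATFree.exists_exec_decompose hn G hG hAT⟩, ?_⟩
  intro V _ _ G hG hAT s x τ σ hτ hx hσ
  have h := hτ.isAdmissibleOrder hAT hx hσ
  exact ⟨ATFree.le_plusGraph x σ, ATFree.plusGraph_le_square h hG σ,
    h.isIntervalGraph_plusGraph hG hσ.lt_iff⟩
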